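/- Let $d\ge 1$, let $\Omega\subset\mathbb R^d$ be a non-empty open set, and let $V\in C^1(\overline\Omega;\mathbb C)$ and $\mathbf A\in C^2(\overline\Omega;\mathbb R^d)$, where $f\in C^k(\overline\Omega)$ means that $f\in C^k(\Omega)$ and all derivatives of $f$ of order at most $k$ extend continuously to $\overline\Omega$. Put $B_{jk}=\partial_jA_k-\partial_kA_j$, $|\mathbf B|=(\sum_{j,k}B_{jk}^2)^{1/2}$, $|\nabla\mathbf B|=(\sum_{j,k}|\nabla B_{jk}|^2)^{1/2}$, and $m=(1+|\mathbf B|^2+|V|^2)^{1/2}$. Assume that, as $|x|\to\infty$ in $\Omega$, $$|\nabla V(x)|+|\nabla\mathbf B(x)|=o\big(m(x)^{3/2}\big),\qquad (\operatorname{Re}V(x))_-=\max(-\operatorname{Re}V(x),0)=o\big(m(x)\big).$$ Let $\|\cdot\|$ and $\langle\cdot,\cdot\rangle$ (linear in the first argument) be the norm and inner product of $L^2(\Omega)$, and understand $-i\nabla+\mathbf A$ and $(-i\nabla+\mathbf A)^2$ in the sense of distributions in $\Omega$. Let $H^1_{\mathbf A}(\Omega)=\{u\in L^2(\Omega): (-i\nabla+\mathbf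 A)u\in L^2(\Omega)\}$, let $H^1_{\mathbf A,0}(\Omega)$ be the closure of $C_c^\infty(\Omega)$ in it for the norm $(\|u\|^2+\|(-i\nabla+\mathbf A)u\|^2)^{1/2}$, and let $\mathscr V=\{u\in H^1_{\mathbf A,0}(\Omega): |V|^{1/2}u\in L^2(\Omega)\}$. For $u,v\in\mathscr V$ let $$Q(u,v)=\langle(-i\nabla+\mathbf A)u,(-i\nabla+\mathbf A)v\rangle+\int_\Omega Vu\bar v\,dx,$$ and let $\mathscr L$ be the operator in $L^2(\Omega)$ whose domain $\mathrm{Dom}(\mathscr L)$ consists of the $u\in\mathscr V$ for which $v\mapsto Q(u,v)$ is continuous on $\mathscr V$ for the norm of $L^2(\Omega)$, and which is determined by $Q(u,v)=\langle\mathscr Lu,v\rangle$ for all $u\in\mathrm{Dom}(\mathscr L)$ and $v\in\mathscr V$. Then $$\mathrm{Dom}(\mathscr L)=\{u\in\mathscr V:\ (-i\nabla+\mathbf A)^2u\in L^2(\Omega)\ \text{and}\ Vu\in L^2(\Omega)\}.$$ Moreover, for every $\delta>0$ there is $C_\delta>0$ such that, for all $u\in\mathrm{Dom}(\mathscr L)$,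 $$\|\mathscr Lu\|^2\ge(1-\delta)\big(\|(-i\nabla+\mathbf A)^2u\|^2+\|Vu\|^2\big)-C_\delta\|u\|^2.$$ -/

import Mathlib

open MeasureTheory Filter Topology Asymptotics
open scoped ENNReal ContDiff ComplexConjugate

namespace MagneticSchrodinger

/-- The Euclidean space `ℝ^d`. -/
abbrev Euc (d : ℕ) := EuclideanSpace ℝ (Fin d)

/-- The complex Hilbert space `L²(Ω)`. -/
noncomputable abbrev L2 {d : ℕ} (Ω : Set (Euc d)) := Lp ℂ 2 ((volume : Measure (Euc d)).restrict Ω)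

/-- The classical partial derivative `∂ⱼ f (x)`. -/
noncomputable def pderiv {d : ℕ} {F : Type*} [NormedAddCommGroup F] [NormedSpace ℝ F]
    (j : Fin d) (f : Euc d → F) (x : Euc d) : F :=
  fderiv ℝ f x (EuclideanSpace.single j 1)

/-- `f ∈ C^k(Ω̄)` for an open set `Ω`: `f` is of class `C^k` in `Ω` and all its derivatives of order
at most `k` extend continuously to the closure of `Ω`. -/
def ContDiffClosure {d : ℕ} {F : Type*} [NormedAddCommGroup F] [NormedSpace ℝ F]
    (k : ℕ) (f : Euc d → F) (Ω : Set (Euc d)) : Prop :=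
  ContDiffOn ℝ k f Ω ∧
    ∀ m : ℕ, m ≤ k → ∃ G : Euc d → ContinuousMultilinearMap ℝ (fun _ : Fin m => Euc d) F,
      ContinuousOn G (closure Ω) ∧ Set.EqOn G (iteratedFDeriv ℝ m f) Ω

/-! ### The magnetic field and the weight -/

/-- The magnetic matrix `B_{jk} = ∂ⱼ A_k - ∂_k A_j`. -/
noncomputable def magB {d : ℕ} (A : Euc d → Euc d) (j k : Fin d) (x : Euc d) : ℝ :=
  pderiv j (fun y => A y k) x - pderiv k (fun y => A y j) x

/-- `|B(x)| = (∑_{j,k} B_{jk}(x)²)^{1/2}`. -/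
noncomputable def normB {d : ℕ} (A : Euc d → Euc d) (x : Euc d) : ℝ :=
  √(∑ j, ∑ k, magB A j k x ^ 2)

/-- `|∇B(x)| = (∑_{j,k} |∇B_{jk}(x)|²)^{1/2}`. -/
noncomputable def normGradB {d : ℕ} (A : Euc d → Euc d) (x : Euc d) : ℝ :=
  √(∑ j, ∑ k, ∑ l, pderiv l (magB A j k) x ^ 2)

/-- `|∇V(x)| = (∑_l |∂_l V(x)|²)^{1/2}`. -/
noncomputable def normGradV {d : ℕ} (V : Euc d → ℂ) (x : Euc d) : ℝ :=
  √(∑ l, ‖pderiv l V x‖ ^ 2)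

/-- The weight `m_{B,V} = (1 + |B|² + |V|²)^{1/2}`. -/
noncomputable def weight {d : ℕ} (A : Euc d → Euc d) (V : Euc d → ℂ) (x : Euc d) : ℝ :=
  √(1 + normB A x ^ 2 + ‖V x‖ ^ 2)

/-! ### Magnetic Sobolev spaces -/

/-- The test functions, `C_c^∞(Ω)` with complex values. -/
structure IsTest {d : ℕ} (Ω : Set (Euc d)) (φ : Euc d → ℂ) : Prop where
  smooth : ContDiff ℝ ∞ φ
  compact : HasCompactSupport φ
  supp : tsupport φ ⊆ Ω

/-- The classical `P_j φ = (-i∂ⱼ + A_j) φ`. -/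
noncomputable def magP {d : ℕ} (A : Euc d → Euc d) (j : Fin d) (φ : Euc d → ℂ) (x : Euc d) : ℂ :=
  -Complex.I * pderiv j φ x + (A x j : ℂ) * φ x

/-- The formal transpose of `P_j`, namely `i∂ⱼ + A_j`. -/
noncomputable def magPt {d : ℕ} (A : Euc d → Euc d) (j : Fin d) (φ : Euc d → ℂ) (x : Euc d) : ℂ :=
  Complex.I * pderiv j φ x + (A x j : ℂ) * φ x

/-- `(-i∂ⱼ + A_j) u = g` in the sense of distributions in `Ω`. -/
def HasWeakP {d : ℕ} (Ω : Set (Euc d)) (A : Euc d → Euc d) (j : Fin d) (u g : L2 Ω) : Prop :=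
  ∀ φ : Euc d → ℂ, IsTest Ω φ → ∫ x in Ω, g x * φ x = ∫ x in Ω, u x * magPt A j φ x

open Classical in
/-- The `j`-th component of `(-i∇ + A) u` (distributional), as an element of `L²(Ω)`, for `u` in the
magnetic Sobolev space; it is unique, see `HasWeakP.unique`. -/
noncomputable def weakP {d : ℕ} (Ω : Set (Euc d)) (A : Euc d → Euc d) (j : Fin d) (u : L2 Ω) :
    L2 Ω :=
  if h : ∃ g, HasWeakP Ω A j u g then h.choose else 0

/-- `H¹_A(Ω)`, the `u ∈ L²(Ω)` such that `(-i∇ + A) u ∈ L²(Ω)`. -/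
def H1A {d : ℕ} (Ω : Set (Euc d)) (A : Euc d → Euc d) : Set (L2 Ω) :=
  {u | ∀ j, ∃ g, HasWeakP Ω A j u g}

/-- `H¹_{A,0}(Ω)`, the closure of `C_c^∞(Ω)` in `H¹_A(Ω)` for the norm
`(‖u‖² + ‖(-i∇ + A) u‖²)^{1/2}`. -/
def H1A0 {d : ℕ} (Ω : Set (Euc d)) (A : Euc d → Euc d) : Set (L2 Ω) :=
  {u | u ∈ H1A Ω A ∧ ∃ φ : ℕ → Euc d → ℂ, (∀ n, IsTest Ω (φ n)) ∧
    Tendsto (fun n => eLpNorm (fun x => u x - φ n x) 2 (volume.restrict Ω)) atTop (𝓝 0) ∧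
    ∀ j, Tendsto (fun n => eLpNorm (fun x => weakP Ω A j u x - magP A j (φ n) x) 2
      (volume.restrict Ω)) atTop (𝓝 0)}

/-- The variational space `𝒱`, the `u ∈ H¹_{A,0}(Ω)` with `|V|^{1/2} u ∈ L²(Ω)`. -/
def formDomain {d : ℕ} (Ω : Set (Euc d)) (A : Euc d → Euc d) (V : Euc d → ℂ) : Set (L2 Ω) :=
  {u | u ∈ H1A0 Ω A ∧ MemLp (fun x => (√‖V x‖ : ℂ) * u x) 2 (volume.restrict Ω)}

/-- The form `Q(u,v) = ⟨(-i∇+A)u, (-i∇+A)v⟩ + ∫_Ω V u v̄`, linear in `u` and antilinear in `v`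
(Mathlib's inner product is antilinear in its first argument). -/
noncomputable def form {d : ℕ} (Ω : Set (Euc d)) (A : Euc d → Euc d) (V : Euc d → ℂ)
    (u v : L2 Ω) : ℂ :=
  (∑ j, inner ℂ (weakP Ω A j v) (weakP Ω A j u)) + ∫ x in Ω, V x * u x * conj (v x)

/-- `(-i∇ + A)² u = f` in the sense of distributions in `Ω`, for `u ∈ H¹_A(Ω)`: here
`(-i∇ + A)² u = ∑ⱼ (-i∂ⱼ + A_j) gⱼ` with `gⱼ = (-i∂ⱼ + A_j) u ∈ L²(Ω)`. -/
def HasWeakMagLaplacian {d : ℕ} (Ω : Set (Euc d)) (A : Euc d → Euc d) (u f : L2 Ω) : Prop :=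
  u ∈ H1A Ω A ∧ ∀ φ : Euc d → ℂ, IsTest Ω φ →
    ∫ x in Ω, f x * φ x = ∑ j, ∫ x in Ω, weakP Ω A j u x * magPt A j φ x

/-! ### Facts needed to define the operator -/

section Facts

variable {d : ℕ} {Ω : Set (Euc d)} {A : Euc d → Euc d} {V : Euc d → ℂ}

theorem ContDiffClosure.continuousOn {F : Type*} [NormedAddCommGroup F] [NormedSpace ℝ F] {k : ℕ}
    {f : Euc d → F} (h : ContDiffClosure k f Ω) : ContinuousOn f Ω :=
  h.1.continuousOn

theorem memLp_of_supp (hΩ : IsOpen Ω) {ψ : Euc d → ℂ} (hc : HasCompactSupport ψ)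
    (hs : tsupport ψ ⊆ Ω) (hψ : ContinuousOn ψ Ω) : MemLp ψ 2 (volume.restrict Ω) := by
  have : Continuous ψ := continuous_of_tsupport fun x hx =>
    hψ.continuousAt (hΩ.mem_nhds (hs hx))
  exact this.memLp_of_hasCompactSupport hc

theorem IsTest.continuous_pderiv {φ : Euc d → ℂ} (h : IsTest Ω φ) (j : Fin d) :
    Continuous (pderiv j φ) :=
  (h.smooth.continuous_fderiv (by simp)).clm_apply continuous_const

theorem tsupport_pderiv (φ : Euc d → ℂ) (j : Fin d) : tsupport (pderiv j φ) ⊆ tsupport φ :=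
  (closure_mono fun x hx => by
    intro h0
    apply hx
    simp [pderiv, h0]).trans (tsupport_fderiv_subset ℝ)

theorem tsupport_comb (c : ℂ) (φ : Euc d → ℂ) (j : Fin d) :
    tsupport (fun x => c * pderiv j φ x + (A x j : ℂ) * φ x) ⊆ tsupport φ := by
  refine closure_minimal (fun x hx => ?_) (isClosed_tsupport φ)
  by_contra h
  have h1 : pderiv j φ x = 0 := image_eq_zero_of_notMem_tsupport fun h2 => h (tsupport_pderiv φ j h2)
  have h2 : φ x = 0 := image_eq_zero_of_notMem_tsupport h
  exact hx (by simp [h1, h2])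

theorem IsTest.memLp (hΩ : IsOpen Ω) {φ : Euc d → ℂ} (h : IsTest Ω φ) :
    MemLp φ 2 (volume.restrict Ω) :=
  memLp_of_supp hΩ h.compact h.supp h.smooth.continuous.continuousOn

theorem IsTest.memLp_comb (hΩ : IsOpen Ω) (hA : ContinuousOn A Ω) {φ : Euc d → ℂ}
    (h : IsTest Ω φ) (c : ℂ) (j : Fin d) :
    MemLp (fun x => c * pderiv j φ x + (A x j : ℂ) * φ x) 2 (volume.restrict Ω) := by
  refine memLp_of_supp hΩ (h.compact.of_isClosed_subset (isClosed_tsupport _) (tsupport_comb c φ j))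
    ((tsupport_comb c φ j).trans h.supp) ?_
  have hAj : ContinuousOn (fun x => A x j) Ω := by fun_prop
  have := (h.continuous_pderiv j).continuousOn (s := Ω)
  have h3 := h.smooth.continuous.continuousOn (s := Ω)
  fun_prop

theorem IsTest.memLp_magPt (hΩ : IsOpen Ω) (hA : ContinuousOn A Ω) {φ : Euc d → ℂ}
    (h : IsTest Ω φ) (j : Fin d) : MemLp (magPt A j φ) 2 (volume.restrict Ω) :=
  h.memLp_comb hΩ hA Complex.I j

theorem IsTest.memLp_magP (hΩ : IsOpen Ω) (hA : ContinuousOn A Ω) {φ : Euc d → ℂ}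
    (h : IsTest Ω φ) (j : Fin d) : MemLp (magP A j φ) 2 (volume.restrict Ω) :=
  h.memLp_comb hΩ hA (-Complex.I) j

theorem L2.eq_zero_of_test (hΩ : IsOpen Ω) (g : L2 Ω)
    (h : ∀ φ : Euc d → ℂ, IsTest Ω φ → ∫ x in Ω, g x * φ x = 0) : g = 0 := by
  have hg : LocallyIntegrableOn (g : Euc d → ℂ) Ω volume := by
    intro x hx
    obtain ⟨K, hK, hxK, hKΩ⟩ := exists_compact_subset hΩ hx
    refine ⟨K, mem_nhdsWithin_of_mem_nhds (mem_interior_iff_mem_nhds.1 hxK), ?_⟩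
    have h1 : MemLp (g : Euc d → ℂ) 2 (volume.restrict K) :=
      (Lp.memLp g).mono_measure (Measure.restrict_mono hKΩ le_rfl)
    have : IsFiniteMeasure ((volume : Measure (Euc d)).restrict K) :=
      ⟨by simpa using hK.measure_lt_top⟩
    exact h1.integrable (by norm_num)
  have h0 := hΩ.ae_eq_zero_of_integral_contDiff_smul_eq_zero hg (fun r hr hrc hrs => by
    have ht : IsTest Ω (fun x => (r x : ℂ)) := by
      have hts : tsupport (fun x => (r x : ℂ)) ⊆ tsupport r :=
        closure_mono fun x hx => by
          intro h0
          exact hx (by simp [h0])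
      exact ⟨Complex.ofRealCLM.contDiff.comp hr,
        hrc.of_isClosed_subset (isClosed_tsupport _) hts, hts.trans hrs⟩
    rw [← h _ ht]
    have : ∀ x, x ∉ Ω → r x • g x = 0 := fun x hx => by
      rw [image_eq_zero_of_notMem_tsupport fun h2 => hx (hrs h2), zero_smul]
    rw [← setIntegral_eq_integral_of_forall_compl_eq_zero this]
    refine integral_congr_ae (ae_of_all _ fun x => ?_)
    simp [mul_comm])
  rw [Lp.eq_zero_iff_ae_eq_zero]
  exact (ae_restrict_iff' hΩ.measurableSet).2 h0

theorem integrable_mul_of_memLp {f g : Euc d → ℂ} {μ : Measure (Euc d)} (hf : MemLp f 2 μ)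
    (hg : MemLp g 2 μ) : Integrable (fun x => f x * g x) μ :=
  hf.integrable_mul hg

theorem HasWeakP.unique (hΩ : IsOpen Ω) {j : Fin d} {u g g' : L2 Ω} (h : HasWeakP Ω A j u g)
    (h' : HasWeakP Ω A j u g') : g = g' := by
  rw [← sub_eq_zero]
  refine L2.eq_zero_of_test hΩ _ fun φ hφ => ?_
  have e : ∫ x in Ω, (g - g' : L2 Ω) x * φ x = ∫ x in Ω, (g x * φ x - g' x * φ x) := by
    refine integral_congr_ae ?_
    filter_upwards [Lp.coeFn_sub g g'] with x hx
    rw [hx, Pi.sub_apply, sub_mul]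
  rw [e, integral_sub (integrable_mul_of_memLp (Lp.memLp g) (hφ.memLp hΩ))
    (integrable_mul_of_memLp (Lp.memLp g') (hφ.memLp hΩ)), h φ hφ, h' φ hφ, sub_self]

theorem HasWeakP.weakP_eq (hΩ : IsOpen Ω) {j : Fin d} {u g : L2 Ω} (h : HasWeakP Ω A j u g) :
    weakP Ω A j u = g := by
  have hex : ∃ g, HasWeakP Ω A j u g := ⟨g, h⟩
  rw [weakP, dif_pos hex]
  exact hex.choose_spec.unique hΩ h

theorem H1A.hasWeakP {u : L2 Ω} (h : u ∈ H1A Ω A) (j : Fin d) :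
    HasWeakP Ω A j u (weakP Ω A j u) := by
  rw [weakP, dif_pos (h j)]
  exact (h j).choose_spec

theorem HasWeakP.add (hΩ : IsOpen Ω) (hA : ContinuousOn A Ω) {j : Fin d} {u u' g g' : L2 Ω}
    (h : HasWeakP Ω A j u g) (h' : HasWeakP Ω A j u' g') : HasWeakP Ω A j (u + u') (g + g') := by
  have key : ∀ (a b : L2 Ω) (ψ : Euc d → ℂ), MemLp ψ 2 (volume.restrict Ω) →
      ∫ x in Ω, (a + b : L2 Ω) x * ψ x = (∫ x in Ω, a x * ψ x) + ∫ x in Ω, b x * ψ x := by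
    intro a b ψ hψ
    rw [← integral_add (integrable_mul_of_memLp (Lp.memLp a) hψ)
      (integrable_mul_of_memLp (Lp.memLp b) hψ)]
    refine integral_congr_ae ?_
    filter_upwards [Lp.coeFn_add a b] with x hx
    rw [hx, Pi.add_apply, add_mul]
  intro φ hφ
  rw [key _ _ _ (hφ.memLp hΩ), key _ _ _ (hφ.memLp_magPt hΩ hA j), h φ hφ, h' φ hφ]

theorem HasWeakP.smul {j : Fin d} {u g : L2 Ω} (c : ℂ) (h : HasWeakP Ω A j u g) :
    HasWeakP Ω A j (c • u) (c • g) := by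
  have key : ∀ (a : L2 Ω) (ψ : Euc d → ℂ),
      ∫ x in Ω, (c • a : L2 Ω) x * ψ x = c * ∫ x in Ω, a x * ψ x := by
    intro a ψ
    rw [← integral_const_mul]
    refine integral_congr_ae ?_
    filter_upwards [Lp.coeFn_smul c a] with x hx
    rw [hx, Pi.smul_apply, smul_eq_mul, mul_assoc]
  intro φ hφ
  rw [key, key, h φ hφ]

theorem weakP_add (hΩ : IsOpen Ω) (hA : ContinuousOn A Ω) {u v : L2 Ω} (hu : u ∈ H1A Ω A)
    (hv : v ∈ H1A Ω A) (j : Fin d) : weakP Ω A j (u + v) = weakP Ω A j u + weakP Ω A j v :=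
  (HasWeakP.add hΩ hA (H1A.hasWeakP hu j) (H1A.hasWeakP hv j)).weakP_eq hΩ

theorem weakP_smul (hΩ : IsOpen Ω) {u : L2 Ω} (hu : u ∈ H1A Ω A) (c : ℂ) (j : Fin d) :
    weakP Ω A j (c • u) = c • weakP Ω A j u :=
  (HasWeakP.smul c (H1A.hasWeakP hu j)).weakP_eq hΩ

theorem IsTest.add {φ ψ : Euc d → ℂ} (h : IsTest Ω φ) (h' : IsTest Ω ψ) :
    IsTest Ω (fun x => φ x + ψ x) :=
  ⟨h.smooth.add h'.smooth, h.compact.add h'.compact,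
    (tsupport_add φ ψ).trans (Set.union_subset h.supp h'.supp)⟩

theorem IsTest.smul {φ : Euc d → ℂ} (c : ℂ) (h : IsTest Ω φ) : IsTest Ω (fun x => c * φ x) :=
  ⟨contDiff_const.mul h.smooth, h.compact.mul_left,
    (closure_mono fun x (hx : c * φ x ≠ 0) (h0 : φ x = 0) => hx (by simp [h0])).trans h.supp⟩

theorem magP_add {φ ψ : Euc d → ℂ} (h : IsTest Ω φ) (h' : IsTest Ω ψ) (j : Fin d) (x : Euc d) :
    magP A j (fun x => φ x + ψ x) x = magP A j φ x + magP A j ψ x := by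
  have h1 := (h.smooth.differentiable (by simp)) x
  have h2 := (h'.smooth.differentiable (by simp)) x
  simp only [magP, pderiv]
  rw [fderiv_fun_add h1 h2, add_apply]
  ring

theorem magP_smul {φ : Euc d → ℂ} (c : ℂ) (h : IsTest Ω φ) (j : Fin d) (x : Euc d) :
    magP A j (fun x => c * φ x) x = c * magP A j φ x := by
  have h1 := (h.smooth.differentiable (by simp)) x
  simp only [magP, pderiv]
  rw [fderiv_const_mul h1]
  simp only [smul_apply, smul_eq_mul]
  ring

/-- Convergence in `L²(Ω)` is stable under sums. -/
theorem tendsto_add_aux {a b : L2 Ω} {f g : ℕ → Euc d → ℂ}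
    (hf : ∀ n, MemLp (f n) 2 (volume.restrict Ω)) (hg : ∀ n, MemLp (g n) 2 (volume.restrict Ω))
    (h1 : Tendsto (fun n => eLpNorm (fun x => a x - f n x) 2 (volume.restrict Ω)) atTop (𝓝 0))
    (h2 : Tendsto (fun n => eLpNorm (fun x => b x - g n x) 2 (volume.restrict Ω)) atTop (𝓝 0)) :
    Tendsto (fun n => eLpNorm (fun x => (a + b : L2 Ω) x - (f n x + g n x)) 2
      (volume.restrict Ω)) atTop (𝓝 0) := by
  have h3 := h1.add h2
  rw [add_zero] at h3
  refine tendsto_of_tendsto_of_tendsto_of_le_of_le tendsto_const_nhds h3 (fun _ => zero_le)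
    fun n => ?_
  refine le_trans (le_of_eq ?_) (eLpNorm_add_le ((Lp.memLp a).sub (hf n)).1
    ((Lp.memLp b).sub (hg n)).1 (by norm_num))
  refine eLpNorm_congr_ae ?_
  filter_upwards [Lp.coeFn_add a b] with x hx
  simp only [hx, Pi.add_apply]
  ring

theorem tendsto_smul_aux {a : L2 Ω} {f : ℕ → Euc d → ℂ} (c : ℂ)
    (h1 : Tendsto (fun n => eLpNorm (fun x => a x - f n x) 2 (volume.restrict Ω)) atTop (𝓝 0)) :
    Tendsto (fun n => eLpNorm (fun x => (c • a : L2 Ω) x - c * f n x) 2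
      (volume.restrict Ω)) atTop (𝓝 0) := by
  have h3 := ENNReal.Tendsto.const_mul (a := ‖c‖ₑ) h1 (Or.inr enorm_ne_top)
  rw [mul_zero] at h3
  refine h3.congr fun n => ?_
  rw [← eLpNorm_const_smul]
  refine eLpNorm_congr_ae ?_
  filter_upwards [Lp.coeFn_smul c a] with x hx
  simp only [hx, Pi.smul_apply, smul_eq_mul]
  ring

theorem H1A_add (hΩ : IsOpen Ω) (hA : ContinuousOn A Ω) {u v : L2 Ω} (hu : u ∈ H1A Ω A)
    (hv : v ∈ H1A Ω A) : u + v ∈ H1A Ω A :=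
  fun j => ⟨_, HasWeakP.add hΩ hA (H1A.hasWeakP hu j) (H1A.hasWeakP hv j)⟩

theorem H1A_smul {u : L2 Ω} (c : ℂ) (hu : u ∈ H1A Ω A) : c • u ∈ H1A Ω A :=
  fun j => ⟨_, HasWeakP.smul c (H1A.hasWeakP hu j)⟩

theorem formDomain_add (hΩ : IsOpen Ω) (hA : ContinuousOn A Ω) {u v : L2 Ω}
    (hu : u ∈ formDomain Ω A V) (hv : v ∈ formDomain Ω A V) : u + v ∈ formDomain Ω A V := by
  obtain ⟨⟨hu1, φ, hφ, hφ0, hφ1⟩, hu2⟩ := hu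
  obtain ⟨⟨hv1, ψ, hψ, hψ0, hψ1⟩, hv2⟩ := hv
  refine ⟨⟨H1A_add hΩ hA hu1 hv1, fun n x => φ n x + ψ n x, fun n => (hφ n).add (hψ n),
    tendsto_add_aux (fun n => (hφ n).memLp hΩ) (fun n => (hψ n).memLp hΩ) hφ0 hψ0, fun j => ?_⟩, ?_⟩
  · rw [weakP_add hΩ hA hu1 hv1]
    simp only [magP_add (hφ _) (hψ _)]
    exact tendsto_add_aux (fun n => (hφ n).memLp_magP hΩ hA j)
      (fun n => (hψ n).memLp_magP hΩ hA j) (hφ1 j) (hψ1 j)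
  · refine (hu2.add hv2).ae_eq ?_
    filter_upwards [Lp.coeFn_add u v] with x hx
    simp only [hx, Pi.add_apply, mul_add]

theorem formDomain_smul (hΩ : IsOpen Ω) {u : L2 Ω} (c : ℂ)
    (hu : u ∈ formDomain Ω A V) : c • u ∈ formDomain Ω A V := by
  obtain ⟨⟨hu1, φ, hφ, hφ0, hφ1⟩, hu2⟩ := hu
  refine ⟨⟨H1A_smul c hu1, fun n x => c * φ n x, fun n => (hφ n).smul c,
    tendsto_smul_aux c hφ0, fun j => ?_⟩, ?_⟩
  · rw [weakP_smul hΩ hu1]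
    simp only [magP_smul c (hφ _)]
    exact tendsto_smul_aux c (hφ1 j)
  · refine (hu2.const_smul c).ae_eq ?_
    filter_upwards [Lp.coeFn_smul c u] with x hx
    simp only [hx, Pi.smul_apply, smul_eq_mul]
    ring

/-- Test functions belong to the variational space, with the classical `(-i∇ + A) φ`. -/
theorem IsTest.hasWeakP (hΩ : IsOpen Ω) (hA : ContinuousOn A Ω) {φ : Euc d → ℂ}
    (h : IsTest Ω φ) (j : Fin d) :
    HasWeakP Ω A j ((h.memLp hΩ).toLp φ) ((h.memLp_magP hΩ hA j).toLp (magP A j φ)) := by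
  intro ψ hψ
  have e1 : ∫ x in Ω, ((h.memLp_magP hΩ hA j).toLp (magP A j φ)) x * ψ x
      = ∫ x in Ω, magP A j φ x * ψ x := by
    refine integral_congr_ae ?_
    filter_upwards [(h.memLp_magP hΩ hA j).coeFn_toLp] with x hx
    rw [hx]
  have e2 : ∫ x in Ω, ((h.memLp hΩ).toLp φ) x * magPt A j ψ x
      = ∫ x in Ω, φ x * magPt A j ψ x := by
    refine integral_congr_ae ?_
    filter_upwards [(h.memLp hΩ).coeFn_toLp] with x hx
    rw [hx]
  have i1 : Integrable (fun x => fderiv ℝ φ x (EuclideanSpace.single j 1) * ψ x) :=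
    ((h.continuous_pderiv j).mul hψ.smooth.continuous).integrable_of_hasCompactSupport
      hψ.compact.mul_left
  have i2 : Integrable (fun x => φ x * fderiv ℝ ψ x (EuclideanSpace.single j 1)) :=
    (h.smooth.continuous.mul (hψ.continuous_pderiv j)).integrable_of_hasCompactSupport
      h.compact.mul_right
  have i3 : Integrable (fun x => φ x * ψ x) :=
    (h.smooth.continuous.mul hψ.smooth.continuous).integrable_of_hasCompactSupport
      h.compact.mul_right
  have ibp := integral_mul_fderiv_eq_neg_fderiv_mul_of_integrable i1 i2 i3
    (fun x _ => (h.smooth.differentiable (by simp)) x)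
    (fun x _ => (hψ.smooth.differentiable (by simp)) x)
  have hout : ∀ x, x ∉ Ω → φ x = 0 := fun x hx =>
    image_eq_zero_of_notMem_tsupport fun h2 => hx (h.supp h2)
  have hout' : ∀ x, x ∉ Ω → ψ x = 0 := fun x hx =>
    image_eq_zero_of_notMem_tsupport fun h2 => hx (hψ.supp h2)
  rw [← setIntegral_eq_integral_of_forall_compl_eq_zero (s := Ω)
      (f := fun x => φ x * fderiv ℝ ψ x (EuclideanSpace.single j 1))
      (fun x hx => by rw [hout x hx, zero_mul]),
    ← setIntegral_eq_integral_of_forall_compl_eq_zero (s := Ω)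
      (f := fun x => fderiv ℝ φ x (EuclideanSpace.single j 1) * ψ x)
      (fun x hx => by rw [hout' x hx, mul_zero])] at ibp
  rw [e1, e2, ← sub_eq_zero, ← integral_sub
    (integrable_mul_of_memLp (h.memLp_magP hΩ hA j) (hψ.memLp hΩ))
    (integrable_mul_of_memLp (h.memLp hΩ) (hψ.memLp_magPt hΩ hA j))]
  have e3 : ∀ x, magP A j φ x * ψ x - φ x * magPt A j ψ x
      = -Complex.I * (fderiv ℝ φ x (EuclideanSpace.single j 1) * ψ x
        + φ x * fderiv ℝ ψ x (EuclideanSpace.single j 1)) := fun x => by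
    simp only [magP, magPt, pderiv]
    ring
  simp only [e3]
  rw [integral_const_mul, integral_add i1.integrableOn i2.integrableOn, ibp]
  simp

theorem IsTest.mem_formDomain (hΩ : IsOpen Ω) (hA : ContinuousOn A Ω) (hV : ContinuousOn V Ω)
    {φ : Euc d → ℂ} (h : IsTest Ω φ) : (h.memLp hΩ).toLp φ ∈ formDomain Ω A V := by
  have aux : ∀ {ψ : Euc d → ℂ} (hψ : MemLp ψ 2 (volume.restrict Ω)),
      Tendsto (fun _ : ℕ => eLpNorm (fun x => (hψ.toLp ψ) x - ψ x) 2 (volume.restrict Ω))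
        atTop (𝓝 0) := by
    intro ψ hψ
    have : eLpNorm (fun x => (hψ.toLp ψ) x - ψ x) 2 (volume.restrict Ω) = 0 := by
      rw [eLpNorm_congr_ae (g := 0), eLpNorm_zero]
      filter_upwards [hψ.coeFn_toLp] with x hx
      simp [hx]
    simp only [this]
    exact tendsto_const_nhds
  refine ⟨⟨fun j => ⟨_, h.hasWeakP hΩ hA j⟩, fun _ => φ, fun _ => h, aux (h.memLp hΩ),
    fun j => ?_⟩, ?_⟩
  · rw [(h.hasWeakP hΩ hA j).weakP_eq hΩ]
    exact aux (h.memLp_magP hΩ hA j)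
  · have hts : tsupport (fun x => (√‖V x‖ : ℂ) * φ x) ⊆ tsupport φ :=
      closure_mono fun x hx h0 => hx (by simp [h0])
    have h1 : MemLp (fun x => (√‖V x‖ : ℂ) * φ x) 2 (volume.restrict Ω) := by
      refine memLp_of_supp hΩ (h.compact.of_isClosed_subset (isClosed_tsupport _) hts)
        (hts.trans h.supp) ?_
      have h3 := h.smooth.continuous.continuousOn (s := Ω)
      fun_prop
    refine h1.ae_eq ?_
    filter_upwards [(h.memLp hΩ).coeFn_toLp] with x hx
    rw [hx]

/-- The potential part of the form is well defined on the variational space. -/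
theorem integrable_potential (hΩ : IsOpen Ω) (hV : ContinuousOn V Ω) {u v : L2 Ω}
    (hu : u ∈ formDomain Ω A V) (hv : v ∈ formDomain Ω A V) :
    Integrable (fun x => V x * u x * conj (v x)) (volume.restrict Ω) := by
  have hVm : AEStronglyMeasurable V (volume.restrict Ω) :=
    hV.aestronglyMeasurable hΩ.measurableSet
  have hvm : AEStronglyMeasurable (fun x => conj (v x)) (volume.restrict Ω) :=
    Complex.continuous_conj.comp_aestronglyMeasurable (Lp.aestronglyMeasurable v)
  refine (integrable_mul_of_memLp hu.2 hv.2).mono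
    ((hVm.mul (Lp.aestronglyMeasurable u)).mul hvm) (ae_of_all _ fun x => le_of_eq ?_)
  have h := Real.mul_self_sqrt (norm_nonneg (V x))
  simp only [norm_mul, RCLike.norm_conj, Complex.norm_real, Real.norm_eq_abs,
    abs_of_nonneg (Real.sqrt_nonneg _)]
  rw [← h]
  simp only [Real.sqrt_mul_self (Real.sqrt_nonneg _)]
  ring

theorem form_add_left (hΩ : IsOpen Ω) (hA : ContinuousOn A Ω) (hV : ContinuousOn V Ω)
    {u u' v : L2 Ω} (hu : u ∈ formDomain Ω A V) (hu' : u' ∈ formDomain Ω A V)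
    (hv : v ∈ formDomain Ω A V) :
    form Ω A V (u + u') v = form Ω A V u v + form Ω A V u' v := by
  have e : ∫ x in Ω, V x * (u + u' : L2 Ω) x * conj (v x)
      = (∫ x in Ω, V x * u x * conj (v x)) + ∫ x in Ω, V x * u' x * conj (v x) := by
    rw [← integral_add (integrable_potential hΩ hV hu hv) (integrable_potential hΩ hV hu' hv)]
    refine integral_congr_ae ?_
    filter_upwards [Lp.coeFn_add u u'] with x hx
    rw [hx, Pi.add_apply]
    ring
  simp only [form, weakP_add hΩ hA hu.1.1 hu'.1.1, inner_add_right, Finset.sum_add_distrib, e]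
  ring

theorem form_add_right (hΩ : IsOpen Ω) (hA : ContinuousOn A Ω) (hV : ContinuousOn V Ω)
    {u v v' : L2 Ω} (hu : u ∈ formDomain Ω A V) (hv : v ∈ formDomain Ω A V)
    (hv' : v' ∈ formDomain Ω A V) :
    form Ω A V u (v + v') = form Ω A V u v + form Ω A V u v' := by
  have e : ∫ x in Ω, V x * u x * conj ((v + v' : L2 Ω) x)
      = (∫ x in Ω, V x * u x * conj (v x)) + ∫ x in Ω, V x * u x * conj (v' x) := by
    rw [← integral_add (integrable_potential hΩ hV hu hv) (integrable_potential hΩ hV hu hv')]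
    refine integral_congr_ae ?_
    filter_upwards [Lp.coeFn_add v v'] with x hx
    rw [hx, Pi.add_apply, map_add]
    ring
  simp only [form, weakP_add hΩ hA hv.1.1 hv'.1.1, inner_add_left, Finset.sum_add_distrib, e]
  ring

theorem form_smul_left (hΩ : IsOpen Ω) {u : L2 Ω} (v : L2 Ω) (c : ℂ)
    (hu : u ∈ formDomain Ω A V) : form Ω A V (c • u) v = c * form Ω A V u v := by
  have e : ∫ x in Ω, V x * (c • u : L2 Ω) x * conj (v x)
      = c * ∫ x in Ω, V x * u x * conj (v x) := by
    rw [← integral_const_mul]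
    refine integral_congr_ae ?_
    filter_upwards [Lp.coeFn_smul c u] with x hx
    rw [hx, Pi.smul_apply, smul_eq_mul]
    ring
  simp only [form, weakP_smul hΩ hu.1.1, inner_smul_right, e, ← Finset.mul_sum]
  ring

theorem form_smul_right (hΩ : IsOpen Ω) (u : L2 Ω) {v : L2 Ω} (c : ℂ)
    (hv : v ∈ formDomain Ω A V) : form Ω A V u (c • v) = conj c * form Ω A V u v := by
  have e : ∫ x in Ω, V x * u x * conj ((c • v : L2 Ω) x)
      = conj c * ∫ x in Ω, V x * u x * conj (v x) := by
    rw [← integral_const_mul]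
    refine integral_congr_ae ?_
    filter_upwards [Lp.coeFn_smul c v] with x hx
    rw [hx, Pi.smul_apply, smul_eq_mul, map_mul]
    ring
  simp only [form, weakP_smul hΩ hv.1.1, inner_smul_left, e, ← Finset.mul_sum]
  ring

theorem zero_mem_formDomain (hΩ : IsOpen Ω) (hA : ContinuousOn A Ω) (hV : ContinuousOn V Ω) :
    (0 : L2 Ω) ∈ formDomain Ω A V := by
  have h : IsTest Ω (fun _ : Euc d => (0 : ℂ)) :=
    ⟨contDiff_const, HasCompactSupport.zero, by simp [tsupport]⟩
  have h1 := formDomain_smul hΩ 0 (h.mem_formDomain hΩ hA hV)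
  rwa [zero_smul] at h1

end Facts

/-! ### The operator -/

section Operator

variable {d : ℕ} {Ω : Set (Euc d)} {A : Euc d → Euc d} {V : Euc d → ℂ}

/-- `Dom(𝓛)`, the `u ∈ 𝒱` such that `v ↦ Q(u,v)` is continuous on `𝒱` for the norm (hence the
subspace topology) of `L²(Ω)`. -/
noncomputable def operatorDomain (hΩ : IsOpen Ω) (hA : ContinuousOn A Ω)
    (hV : ContinuousOn V Ω) : Submodule ℂ (L2 Ω) where
  carrier := {u | u ∈ formDomain Ω A V ∧ Continuous fun v : formDomain Ω A V => form Ω A V u v}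
  add_mem' := fun {u u'} hu hu' => ⟨formDomain_add hΩ hA hu.1 hu'.1,
    (hu.2.add hu'.2).congr fun v => (form_add_left hΩ hA hV hu.1 hu'.1 v.2).symm⟩
  zero_mem' := ⟨zero_mem_formDomain hΩ hA hV, continuous_const.congr fun v => by
    have := form_smul_left (V := V) hΩ v.1 0 (zero_mem_formDomain hΩ hA hV)
    rw [zero_smul, zero_mul] at this
    exact this.symm⟩
  smul_mem' := fun c u hu => ⟨formDomain_smul hΩ c hu.1,
    (continuous_const.mul hu.2).congr fun v => (form_smul_left hΩ v.1 c hu.1).symm⟩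

/-- Riesz representation of `v ↦ Q(u,v)` for `u ∈ Dom(𝓛)`. -/
theorem exists_riesz (hΩ : IsOpen Ω) (hA : ContinuousOn A Ω) (hV : ContinuousOn V Ω)
    {u : L2 Ω} (hu : u ∈ operatorDomain hΩ hA hV) :
    ∃ f : L2 Ω, ∀ v ∈ formDomain Ω A V, form Ω A V u v = inner ℂ v f := by
  let p : Submodule ℂ (L2 Ω) :=
    { carrier := formDomain Ω A V
      add_mem' := fun h h' => formDomain_add hΩ hA h h'
      zero_mem' := zero_mem_formDomain hΩ hA hV
      smul_mem' := fun c _ h => formDomain_smul hΩ c h }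
  let l : p →L[ℂ] ℂ :=
    { toFun := fun v => conj (form Ω A V u v)
      map_add' := fun v w => by
        rw [← map_add, ← form_add_right hΩ hA hV hu.1 v.2 w.2, Submodule.coe_add]
      map_smul' := fun c v => by
        rw [Submodule.coe_smul, form_smul_right hΩ u c v.2, map_mul, Complex.conj_conj]
        rfl
      cont := Complex.continuous_conj.comp hu.2 }
  obtain ⟨F, hF, -⟩ := exists_extension_norm_eq p l
  refine ⟨(InnerProductSpace.toDual ℂ (L2 Ω)).symm F, fun v hv => ?_⟩
  have h1 : F v = conj (form Ω A V u v) := hF ⟨v, hv⟩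
  rw [← inner_conj_symm, InnerProductSpace.toDual_symm_apply, h1, Complex.conj_conj]

theorem riesz_unique (hΩ : IsOpen Ω) (hA : ContinuousOn A Ω) (hV : ContinuousOn V Ω)
    {f g : L2 Ω} (h : ∀ v ∈ formDomain Ω A V, inner ℂ v f = inner ℂ v g) : f = g := by
  rw [← sub_eq_zero]
  refine L2.eq_zero_of_test hΩ _ fun φ hφ => ?_
  have hψ : IsTest Ω (fun x => conj (φ x)) := by
    have hts : tsupport (fun x => conj (φ x)) ⊆ tsupport φ :=
      closure_mono fun x (hx : conj (φ x) ≠ 0) (h0 : φ x = 0) => hx (by simp [h0])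
    exact ⟨Complex.conjCLE.contDiff.comp hφ.smooth,
      hφ.compact.of_isClosed_subset (isClosed_tsupport _) hts, hts.trans hφ.supp⟩
  have h1 := h _ (hψ.mem_formDomain hΩ hA hV)
  rw [← sub_eq_zero, ← inner_sub_right, MeasureTheory.L2.inner_def] at h1
  rw [← h1]
  refine integral_congr_ae ?_
  filter_upwards [(hψ.memLp hΩ).coeFn_toLp] with x hx
  simp [hx]

/-- The operator `𝓛` in `L²(Ω)` associated with the form: `Q(u,v) = ⟨𝓛u, v⟩` for all
`u ∈ Dom(𝓛)` and `v ∈ 𝒱`. -/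
noncomputable def schrodingerOp (hΩ : IsOpen Ω) (hA : ContinuousOn A Ω)
    (hV : ContinuousOn V Ω) : L2 Ω →ₗ.[ℂ] L2 Ω where
  domain := operatorDomain hΩ hA hV
  toFun :=
    { toFun := fun u => (exists_riesz hΩ hA hV u.2).choose
      map_add' := fun u u' => riesz_unique hΩ hA hV fun v hv => by
        rw [inner_add_right, ← (exists_riesz hΩ hA hV u.2).choose_spec v hv,
          ← (exists_riesz hΩ hA hV u'.2).choose_spec v hv,
          ← (exists_riesz hΩ hA hV (u + u').2).choose_spec v hv, Submodule.coe_add,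
          form_add_left hΩ hA hV u.2.1 u'.2.1 hv]
      map_smul' := fun c u => riesz_unique hΩ hA hV fun v hv => by
        rw [RingHom.id_apply, inner_smul_right, ← (exists_riesz hΩ hA hV u.2).choose_spec v hv,
          ← (exists_riesz hΩ hA hV (c • u).2).choose_spec v hv, Submodule.coe_smul,
          form_smul_left hΩ v c u.2.1] }

theorem schrodingerOp_spec (hΩ : IsOpen Ω) (hA : ContinuousOn A Ω) (hV : ContinuousOn V Ω)
    (u : (schrodingerOp hΩ hA hV).domain) {v : L2 Ω} (hv : v ∈ formDomain Ω A V) :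
    form Ω A V u v = inner ℂ v (schrodingerOp hΩ hA hV u) :=
  (exists_riesz hΩ hA hV u.2).choose_spec v hv

end Operator

end MagneticSchrodinger

open MagneticSchrodinger

/-! Write `P = -i∇ + A`. If `Q(u, v) = ⟨f, v⟩` on the form domain, then formally `f = P²u + Vu`, and
everything reduces to two facts: `Vu ∈ L²`, and the cross term `Re ⟨P²u, Vu⟩` is bounded below by
small multiples of `‖u‖² + ‖f‖²` plus lower order terms. Both come from testing the form with
multiples of `u` itself.

Two integrals are estimated together: `X = ∫ m |Pu|²` and `Y = ∫ m² |u|²`. Testing with `v = m u`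
bounds `X`, because `Re V ≥ -o(m)`. Testing with `v = V u` bounds `∫ |V|²|u|²` by `X`. The
commutator `[P_j, P_k] = -i B_jk`, tested against `B_jk u`, bounds `∫ B_jk² |u|²` by `2X`. Since `m²
= 1 + |B|² + |V|²`, this gives `Y ≲ X`, and the system closes. Each test leaves an error in which
one derivative falls on `m`, `V` or `B_jk`. The hypothesis makes that derivative `o(m^{3/2})`, and
`m^{3/2} |u||Pu| ≤ (m |Pu|² + m² |u|²) / 2`, so the error is a small multiple of `X + Y` plus `C
‖u‖²`. This is the role of the exponent 3/2.

A priori `X` and `Y` may be infinite and `m u` may leave the form domain. Every multiplier therefore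
carries the factor `damp = (1 + s m²)⁻²`, which makes it bounded with bounded gradient. Its
logarithmic gradient is at most `4 (|∇V| + |∇B|) / m`, so the constants do not depend on `s`
(`Admissible.exists_kinetic_add_potential_le`). Fatou's lemma as `s → 0` gives `Vu ∈ L²`
(`Admissible.memLp_potential_mul`). The same test with the damped `V u`, followed by `s → 0`, gives
the cross term (`Admissible.exists_re_inner_ge`), and expanding `‖P²u + Vu‖²` finishes
(`Admissible.exists_separation`).

No regularity of the boundary is needed: identities are checked on `C_c^∞(Ω)` and pass to the closed
graph `magGraph`. -/

namespace MagneticSchrodinger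

/-! ### Mollification of compactly supported `C¹` functions. -/

section Approximation

variable {d : ℕ} {Ω : Set (Euc d)} {A : Euc d → Euc d} {V : Euc d → ℂ}

/-- A `C¹` function with compact support in `Ω` is a `C¹`-limit of test functions supported in a
fixed compact subset of `Ω`. -/
theorem exists_isTest_approx (hΩ : IsOpen Ω) {h : Euc d → ℂ} (hh : ContDiff ℝ 1 h)
    (hc : HasCompactSupport h) (hs : tsupport h ⊆ Ω) :
    ∃ K : Set (Euc d), IsCompact K ∧ K ⊆ Ω ∧ tsupport h ⊆ K ∧ ∀ ε : ℝ, 0 < ε →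
      ∃ φ : Euc d → ℂ, IsTest Ω φ ∧ tsupport φ ⊆ K ∧ (∀ x, ‖φ x - h x‖ ≤ ε) ∧
        ∀ j x, ‖pderiv j φ x - pderiv j h x‖ ≤ ε := by
  obtain ⟨δ, hδ, hδΩ⟩ := IsCompact.exists_cthickening_subset_open hc hΩ hs
  refine ⟨Metric.cthickening δ (tsupport h), IsCompact.cthickening hc, hδΩ,
    Metric.self_subset_cthickening _, fun ε hε => ?_⟩
  have hder : Continuous (fderiv ℝ h) := hh.continuous_fderiv (by simp)
  have hsupp' : ∀ j, HasCompactSupport (pderiv j h) := fun j =>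
    IsCompact.of_isClosed_subset hc (isClosed_tsupport _) (tsupport_pderiv h j)
  have hcont' : ∀ j, Continuous (pderiv j h) := fun j => hder.clm_apply continuous_const
  obtain ⟨r₁, hr₁, H₁⟩ := Metric.uniformContinuous_iff.1
    (hc.uniformContinuous_of_continuous hh.continuous) ε hε
  obtain ⟨r₂, hr₂, H₂⟩ := Metric.uniformContinuous_iff.1
    ((hc.fderiv (𝕜 := ℝ)).uniformContinuous_of_continuous hder) ε hε
  -- `δ` keeps the mollified function supported in the thickening; `r₁` and `r₂` are moduli of
  -- uniform continuity of `h` and of its derivative, so one radius serves both sup bounds.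
  set r := min δ (min r₁ r₂) with hr
  have hrpos : 0 < r := lt_min hδ (lt_min hr₁ hr₂)
  let b : ContDiffBump (0 : Euc d) := ⟨r / 2, r, half_pos hrpos, half_lt_self hrpos⟩
  have hbint : LocallyIntegrable (b.normed volume) volume := b.integrable_normed.locallyIntegrable
  set φ : Euc d → ℂ :=
    convolution (b.normed volume) h (ContinuousLinearMap.lsmul ℝ ℝ) volume with hφ
  have hφd : ∀ j x, pderiv j φ x = convolution (b.normed volume) (pderiv j h)
      (ContinuousLinearMap.lsmul ℝ ℝ) volume x := by
    intro j x
    have h1 := hc.hasFDerivAt_convolution_right (ContinuousLinearMap.lsmul ℝ ℝ) hbint hh x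
    rw [pderiv, h1.fderiv, convolution_precompR_apply _ hbint (hc.fderiv (𝕜 := ℝ)) hder]
    rfl
  have hφs : tsupport φ ⊆ Metric.cthickening δ (tsupport h) := by
    refine closure_minimal (fun x hx => ?_) Metric.isClosed_cthickening
    by_contra hx'
    have hz : ∀ y ∈ Metric.ball x r, h y = 0 := fun y hy =>
      image_eq_zero_of_notMem_tsupport fun hy' => hx' <|
        Metric.mem_cthickening_of_dist_le x y δ _ hy'
          ((dist_comm x y).le.trans ((Metric.mem_ball.1 hy).le.trans (min_le_left _ _)))
    have h0 := hz x (Metric.mem_ball_self hrpos)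
    refine hx ?_
    rw [hφ, b.normed_convolution_eq_right (μ := volume) (x₀ := x)
      (fun y hy => by rw [hz y hy, h0]), h0]
  refine ⟨φ, ⟨?_, ?_, hφs.trans hδΩ⟩, hφs, fun x => ?_, fun j x => ?_⟩
  · exact b.hasCompactSupport_normed.contDiff_convolution_left _ b.contDiff_normed
      hh.continuous.locallyIntegrable
  · exact IsCompact.of_isClosed_subset (IsCompact.cthickening hc) (isClosed_tsupport _) hφs
  · rw [← dist_eq_norm]
    refine b.dist_normed_convolution_le hh.continuous.aestronglyMeasurable fun y hy => ?_
    exact (H₁ ((Metric.mem_ball.1 hy).trans_le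
      ((min_le_right _ _).trans (min_le_left _ _)))).le
  · rw [← dist_eq_norm, hφd]
    refine b.dist_normed_convolution_le (hcont' j).aestronglyMeasurable fun y hy => ?_
    have h1 := H₂ ((Metric.mem_ball.1 hy).trans_le
      ((min_le_right _ _).trans (min_le_right _ _)))
    rw [dist_eq_norm] at h1 ⊢
    refine le_trans ?_ h1.le
    have h2 := (fderiv ℝ h y - fderiv ℝ h x).le_opNorm (EuclideanSpace.single j 1)
    simpa [pderiv] using h2

end Approximation

/-! ### Bounded multiplication operators on `L²(Ω)`. -/

section Multiplication

variable {d : ℕ} {Ω : Set (Euc d)}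

/-- A function that is continuous and bounded on `Ω`. -/
structure BddOn (Ω : Set (Euc d)) (c : Euc d → ℂ) : Prop where
  continuousOn : ContinuousOn c Ω
  bound : ∃ K : ℝ, ∀ x ∈ Ω, ‖c x‖ ≤ K

theorem BddOn.memLp_top (hΩ : IsOpen Ω) {c : Euc d → ℂ} (hc : BddOn Ω c) :
    MemLp c ∞ (volume.restrict Ω) := by
  obtain ⟨K, hK⟩ := hc.bound
  exact memLp_top_of_bound (hc.continuousOn.aestronglyMeasurable hΩ.measurableSet) K
    ((ae_restrict_iff' hΩ.measurableSet).2 (ae_of_all _ hK))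

/-- Multiplication by a bounded continuous function, as an operator in `L²(Ω)`. -/
noncomputable def mulOp (hΩ : IsOpen Ω) {c : Euc d → ℂ} (hc : BddOn Ω c) : L2 Ω →L[ℂ] L2 Ω :=
  (ContinuousLinearMap.mul ℂ ℂ).holderL (volume.restrict Ω) ∞ 2 2
    ((hc.memLp_top hΩ).toLp c)

theorem mulOp_coeFn (hΩ : IsOpen Ω) {c : Euc d → ℂ} (hc : BddOn Ω c) (u : L2 Ω) :
    mulOp hΩ hc u =ᵐ[volume.restrict Ω] fun x => c x * u x := by
  have h := (ContinuousLinearMap.mul ℂ ℂ).coeFn_holder (r := 2) ((hc.memLp_top hΩ).toLp c) u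
  filter_upwards [h, (hc.memLp_top hΩ).coeFn_toLp] with x h1 h2
  change (ContinuousLinearMap.holder 2 (ContinuousLinearMap.mul ℂ ℂ) _ u : L2 Ω) x = _
  rw [h1, h2]
  rfl

end Multiplication

/-! ### The closed graph of `-i∇ + A` with Dirichlet condition. -/

section Graph

variable {d : ℕ} {Ω : Set (Euc d)} {A : Euc d → Euc d} {V : Euc d → ℂ}

/-- The pairing is the inner product with `star ψ`. It makes distributional identities closed
conditions, so that they survive passage to the closure. -/
theorem continuous_integral_mul {ψ : Euc d → ℂ} (hψ : MemLp ψ 2 (volume.restrict Ω)) :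
    Continuous fun u : L2 Ω => ∫ x in Ω, u x * ψ x := by
  have h := (innerSL ℂ ((hψ.star).toLp (star ψ) : L2 Ω)).continuous
  refine h.congr fun u => ?_
  rw [innerSL_apply_apply, MeasureTheory.L2.inner_def]
  refine integral_congr_ae ?_
  filter_upwards [(hψ.star).coeFn_toLp] with x hx
  simp [hx]

/-- The graph of `u ↦ (-i∇ + A) u` on `H¹_{A,0}(Ω)`, as the closure of its restriction to
`C_c^∞(Ω)`. -/
def magGraph (Ω : Set (Euc d)) (A : Euc d → Euc d) : Set (L2 Ω × (Fin d → L2 Ω)) :=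
  closure {p | ∃ φ : Euc d → ℂ, IsTest Ω φ ∧ p.1 =ᵐ[volume.restrict Ω] φ ∧
    ∀ j, p.2 j =ᵐ[volume.restrict Ω] magP A j φ}

theorem hasWeakP_of_mem_magGraph (hΩ : IsOpen Ω) (hA : ContinuousOn A Ω)
    {p : L2 Ω × (Fin d → L2 Ω)} (hp : p ∈ magGraph Ω A) (j : Fin d) :
    HasWeakP Ω A j p.1 (p.2 j) := by
  intro φ hφ
  refine closure_minimal (t := {p : L2 Ω × (Fin d → L2 Ω) |
    ∫ x in Ω, p.2 j x * φ x = ∫ x in Ω, p.1 x * magPt A j φ x}) ?_ ?_ hp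
  · rintro ⟨u, g⟩ ⟨ψ, hψ, hu, hg⟩
    have e1 : u = (hψ.memLp hΩ).toLp ψ := Lp.ext (hu.trans (MemLp.coeFn_toLp _).symm)
    have e2 : g j = (hψ.memLp_magP hΩ hA j).toLp (magP A j ψ) :=
      Lp.ext ((hg j).trans (MemLp.coeFn_toLp _).symm)
    simp only [Set.mem_ofPred_eq]
    rw [e1, e2]
    exact hψ.hasWeakP hΩ hA j φ hφ
  · exact isClosed_eq ((continuous_integral_mul (hφ.memLp hΩ)).comp
      ((continuous_apply j).comp continuous_snd))
      ((continuous_integral_mul (hφ.memLp_magPt hΩ hA j)).comp continuous_fst)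

/-- Passes from approximating sequences to a topological closure, so that later density arguments
are single calls to `closure_minimal`. Uniqueness of weak derivatives identifies the second
component. -/
theorem mem_magGraph_iff (hΩ : IsOpen Ω) (hA : ContinuousOn A Ω) {u : L2 Ω} {g : Fin d → L2 Ω} :
    (u, g) ∈ magGraph Ω A ↔ u ∈ H1A0 Ω A ∧ g = fun j => weakP Ω A j u := by
  constructor
  · intro h
    have hw := hasWeakP_of_mem_magGraph hΩ hA h
    have hg : g = fun j => weakP Ω A j u := funext fun j => ((hw j).weakP_eq hΩ).symm
    refine ⟨⟨fun j => ⟨_, hw j⟩, ?_⟩, hg⟩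
    obtain ⟨p, hp, hlim⟩ := mem_closure_iff_seq_limit.1 h
    choose φ hφ h1 h2 using hp
    have l1 := ((continuous_fst.tendsto _).comp hlim)
    have l2 := fun j => (((continuous_apply j).comp continuous_snd).tendsto _).comp hlim
    refine ⟨φ, hφ, ?_, fun j => ?_⟩
    · rw [Lp.tendsto_Lp_iff_tendsto_eLpNorm'] at l1
      refine l1.congr fun n => ?_
      rw [← eLpNorm_neg]
      refine eLpNorm_congr_ae ?_
      filter_upwards [h1 n] with x hx
      simp [hx]
    · have l := l2 j
      rw [Lp.tendsto_Lp_iff_tendsto_eLpNorm'] at l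
      refine l.congr fun n => ?_
      rw [← eLpNorm_neg]
      refine eLpNorm_congr_ae ?_
      filter_upwards [h2 n j] with x hx
      simp [hx, hg]
  · rintro ⟨⟨-, φ, hφ, h1, h2⟩, rfl⟩
    refine mem_closure_iff_seq_limit.2 ⟨fun n => ((hφ n).memLp hΩ |>.toLp (φ n),
      fun j => ((hφ n).memLp_magP hΩ hA j).toLp (magP A j (φ n))), fun n =>
      ⟨φ n, hφ n, ((hφ n).memLp hΩ).coeFn_toLp, fun j => ((hφ n).memLp_magP hΩ hA j).coeFn_toLp⟩, ?_⟩
    refine Tendsto.prodMk_nhds ?_ (tendsto_pi_nhds.2 fun j => ?_)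
    · rw [Lp.tendsto_Lp_iff_tendsto_eLpNorm']
      refine h1.congr fun n => ?_
      rw [← eLpNorm_neg]
      refine eLpNorm_congr_ae ?_
      filter_upwards [((hφ n).memLp hΩ).coeFn_toLp] with x hx
      simp [hx]
    · rw [Lp.tendsto_Lp_iff_tendsto_eLpNorm']
      refine (h2 j).congr fun n => ?_
      rw [← eLpNorm_neg]
      refine eLpNorm_congr_ae ?_
      filter_upwards [((hφ n).memLp_magP hΩ hA j).coeFn_toLp] with x hx
      simp [hx]

theorem tendsto_eLpNorm_of_bound_on_compact {K : Set (Euc d)} (hK : IsCompact K)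
    {f : ℕ → Euc d → ℂ} {C : ℝ} (hs : ∀ n, Function.support (f n) ⊆ K)
    (hf : ∀ n, ∀ x ∈ K, ‖f n x‖ ≤ C * (1 / ((n : ℝ) + 1))) :
    Tendsto (fun n => eLpNorm (f n) 2 (volume.restrict Ω)) atTop (𝓝 0) := by
  have hlim : Tendsto (fun n : ℕ => (volume.restrict K Set.univ) ^ (ENNReal.toReal 2)⁻¹ *
      ENNReal.ofReal (C * (1 / ((n : ℝ) + 1)))) atTop (𝓝 0) := by
    have h1 : Tendsto (fun n : ℕ => C * (1 / ((n : ℝ) + 1))) atTop (𝓝 0) := by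
      simpa using tendsto_one_div_add_atTop_nhds_zero_nat.const_mul C
    have h2 := ENNReal.tendsto_ofReal h1
    rw [ENNReal.ofReal_zero] at h2
    have h3 : (volume.restrict K Set.univ) ^ (ENNReal.toReal 2)⁻¹ ≠ ⊤ :=
      ENNReal.rpow_ne_top_of_nonneg (by norm_num) (by simpa using (hK.measure_lt_top (μ := volume)).ne)
    simpa using ENNReal.Tendsto.const_mul h2 (Or.inr h3)
  refine tendsto_of_tendsto_of_tendsto_of_le_of_le tendsto_const_nhds hlim (fun _ => zero_le)
    fun n => ?_
  calc eLpNorm (f n) 2 (volume.restrict Ω) ≤ eLpNorm (f n) 2 volume :=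
        eLpNorm_mono_measure _ Measure.restrict_le_self
    _ = eLpNorm (f n) 2 (volume.restrict K) :=
        (eLpNorm_restrict_eq_of_support_subset (hs n)).symm
    _ ≤ _ := eLpNorm_le_of_ae_bound
        ((ae_restrict_iff' hK.measurableSet).2 (ae_of_all _ (hf n)))

theorem tsupport_magP (φ : Euc d → ℂ) (j : Fin d) : tsupport (magP A j φ) ⊆ tsupport φ :=
  tsupport_comb (-Complex.I) φ j

/-- `C¹` functions with compact support in `Ω` belong to `H¹_{A,0}(Ω)`. -/
theorem mem_magGraph_of_contDiff (hΩ : IsOpen Ω) (hA : ContinuousOn A Ω) {h : Euc d → ℂ}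
    (hh : ContDiff ℝ 1 h) (hc : HasCompactSupport h) (hs : tsupport h ⊆ Ω)
    {p : L2 Ω × (Fin d → L2 Ω)} (h1 : p.1 =ᵐ[volume.restrict Ω] h)
    (h2 : ∀ j, p.2 j =ᵐ[volume.restrict Ω] magP A j h) : p ∈ magGraph Ω A := by
  obtain ⟨K, hK, hKΩ, hhK, H⟩ := exists_isTest_approx hΩ hh hc hs
  choose φ hφ hφK hφ0 hφ1 using fun n : ℕ => H (1 / ((n : ℝ) + 1)) Nat.one_div_pos_of_nat
  have z : ∀ (n : ℕ) x, x ∉ K → φ n x = 0 := fun n x hx =>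
    image_eq_zero_of_notMem_tsupport fun h => hx (hφK n h)
  have zh : ∀ x, x ∉ K → h x = 0 := fun x hx =>
    image_eq_zero_of_notMem_tsupport fun h => hx (hhK h)
  refine mem_closure_iff_seq_limit.2 ⟨fun n => ((hφ n).memLp hΩ |>.toLp (φ n),
      fun j => ((hφ n).memLp_magP hΩ hA j).toLp (magP A j (φ n))), fun n =>
      ⟨φ n, hφ n, ((hφ n).memLp hΩ).coeFn_toLp, fun j => ((hφ n).memLp_magP hΩ hA j).coeFn_toLp⟩, ?_⟩
  refine Tendsto.prodMk_nhds (x := p.1) (y := p.2) ?_ (tendsto_pi_nhds.2 fun j => ?_)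
  · rw [Lp.tendsto_Lp_iff_tendsto_eLpNorm']
    refine (tendsto_eLpNorm_of_bound_on_compact (Ω := Ω) hK (f := fun n x => φ n x - h x) (C := 1)
      (fun n x hx => ?_) (fun n x _ => by simpa using hφ0 n x)).congr fun n => ?_
    · by_contra hxK
      exact hx (by simp [z n x hxK, zh x hxK])
    · refine eLpNorm_congr_ae ?_
      filter_upwards [((hφ n).memLp hΩ).coeFn_toLp, h1] with x hx hx'
      simp [hx, hx']
  -- `A` need not be bounded on `Ω`, but it is on the fixed compact `K`. The derivative part of `P_j
  -- (φ n - h)` contributes 1 and the zero order part `C`, whence `1 + C`.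
  · obtain ⟨C, hC⟩ := hK.exists_bound_of_continuousOn (f := fun x => A x j)
      ((show ContinuousOn (fun x => A x j) Ω by fun_prop).mono hKΩ)
    rw [Lp.tendsto_Lp_iff_tendsto_eLpNorm']
    refine (tendsto_eLpNorm_of_bound_on_compact (Ω := Ω) hK
      (f := fun n x => magP A j (φ n) x - magP A j h x) (C := 1 + C)
      (fun n x hx => ?_) (fun n x hx => ?_)).congr fun n => ?_
    · by_contra hxK
      refine hx ?_
      have a1 : magP A j (φ n) x = 0 := image_eq_zero_of_notMem_tsupport fun h' =>
        hxK (hφK n (tsupport_magP _ j h'))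
      have a2 : magP A j h x = 0 := image_eq_zero_of_notMem_tsupport fun h' =>
        hxK (hhK (tsupport_magP _ j h'))
      simp [a1, a2]
    · have e : magP A j (φ n) x - magP A j h x
          = -Complex.I * (pderiv j (φ n) x - pderiv j h x) + (A x j : ℂ) * (φ n x - h x) := by
        simp only [magP]
        ring
      rw [e, add_mul]
      refine (norm_add_le _ _).trans (add_le_add ?_ ?_)
      · simpa using hφ1 n j x
      · rw [norm_mul]
        refine mul_le_mul ?_ (hφ0 n x) (norm_nonneg _) ((norm_nonneg _).trans (hC x hx))
        simpa using hC x hx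
    · refine eLpNorm_congr_ae ?_
      filter_upwards [((hφ n).memLp_magP hΩ hA j).coeFn_toLp, h2 j] with x hx hx'
      simp [hx, hx']

end Graph

/-! ### `C¹` multipliers and the Leibniz rule. -/

section Multiplier

variable {d : ℕ} {Ω : Set (Euc d)} {A : Euc d → Euc d} {V : Euc d → ℂ}

/-- A `C¹` function on `Ω` that is bounded together with its first derivatives. -/
structure IsMultiplier (Ω : Set (Euc d)) (w : Euc d → ℂ) : Prop where
  contDiffOn : ContDiffOn ℝ 1 w Ω
  bddOn : BddOn Ω w
  bddOn_pderiv : ∀ j, BddOn Ω (pderiv j w)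

theorem pderiv_mul {f g : Euc d → ℂ} {x : Euc d} (hf : DifferentiableAt ℝ f x)
    (hg : DifferentiableAt ℝ g x) (j : Fin d) :
    pderiv j (fun y => f y * g y) x = f x * pderiv j g x + pderiv j f x * g x := by
  simp only [pderiv]
  rw [fderiv_fun_mul hf hg]
  simp [mul_comm]

theorem contDiff_of_tsupport_subset {n : WithTop ℕ∞} (hΩ : IsOpen Ω) {F : Type*}
    [NormedAddCommGroup F] [NormedSpace ℝ F] {f : Euc d → F}
    (hf : ContDiffOn ℝ n f Ω) (hs : tsupport f ⊆ Ω) : ContDiff ℝ n f :=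
  contDiff_iff_contDiffAt.2 fun x => by
    by_cases hx : x ∈ tsupport f
    · exact hf.contDiffAt (hΩ.mem_nhds (hs hx))
    · exact contDiffAt_const.congr_of_eventuallyEq (notMem_tsupport_iff_eventuallyEq.1 hx)

/-- Leibniz rule `P_j (w u) = w P_j u - i (∂_j w) u`. Both sides are continuous on the graph, so
test functions suffice; there `w φ` is only `C¹`, which is why mollification was needed. This is
what makes `w u` an admissible test vector for `Q`. -/
theorem IsMultiplier.mem_magGraph (hΩ : IsOpen Ω) (hA : ContinuousOn A Ω) {w : Euc d → ℂ}
    (hw : IsMultiplier Ω w) {u : L2 Ω} {g : Fin d → L2 Ω} (h : (u, g) ∈ magGraph Ω A) :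
    (mulOp hΩ hw.bddOn u, fun j => mulOp hΩ hw.bddOn (g j)
      - Complex.I • mulOp hΩ (hw.bddOn_pderiv j) u) ∈ magGraph Ω A := by
  have hcont : Continuous fun p : L2 Ω × (Fin d → L2 Ω) => (mulOp hΩ hw.bddOn p.1,
      fun j => mulOp hΩ hw.bddOn (p.2 j) - Complex.I • mulOp hΩ (hw.bddOn_pderiv j) p.1) := by
    fun_prop
  refine Set.MapsTo.closure_left (t := magGraph Ω A) ?_ hcont isClosed_closure h
  rintro p ⟨φ, hφ, h1, h2⟩
  have hts : tsupport (fun x => w x * φ x) ⊆ tsupport φ := tsupport_mul_subset_right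
  have hφ1 : ContDiff ℝ 1 φ := hφ.smooth.of_le (by exact_mod_cast le_top)
  refine mem_magGraph_of_contDiff hΩ hA (h := fun x => w x * φ x)
    (contDiff_of_tsupport_subset hΩ (hw.contDiffOn.mul hφ1.contDiffOn) (hts.trans hφ.supp))
    hφ.compact.mul_left (hts.trans hφ.supp) ?_ fun j => ?_
  · filter_upwards [mulOp_coeFn hΩ hw.bddOn p.1, h1] with x a1 a2
    rw [a1, a2]
  · filter_upwards [mulOp_coeFn hΩ hw.bddOn (p.2 j), mulOp_coeFn hΩ (hw.bddOn_pderiv j) p.1,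
      h1, h2 j, Lp.coeFn_sub (mulOp hΩ hw.bddOn (p.2 j))
        (Complex.I • mulOp hΩ (hw.bddOn_pderiv j) p.1),
      Lp.coeFn_smul Complex.I (mulOp hΩ (hw.bddOn_pderiv j) p.1),
      ae_restrict_mem hΩ.measurableSet] with x a1 a2 a3 a4 a5 a6 hx
    rw [a5, Pi.sub_apply, a6, Pi.smul_apply, a1, a2, a3, a4, magP, magP, pderiv_mul
      ((hw.contDiffOn.differentiableOn (by simp)).differentiableAt (hΩ.mem_nhds hx))
      (hφ1.differentiable (by simp) x), smul_eq_mul]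
    ring

end Multiplier

/-! ### The commutator identity that produces the magnetic field. -/

section Commutator

variable {d : ℕ} {Ω : Set (Euc d)} {A : Euc d → Euc d} {V : Euc d → ℂ}

theorem integral_pderiv_eq_zero {F : Euc d → ℂ} (hF : ContDiff ℝ 1 F) (hc : HasCompactSupport F)
    (j : Fin d) : ∫ x, pderiv j F x = 0 := by
  have i1 : Integrable (fun x => pderiv j F x) :=
    ((hF.continuous_fderiv (by simp)).clm_apply continuous_const).integrable_of_hasCompactSupport
      (IsCompact.of_isClosed_subset hc (isClosed_tsupport _) (tsupport_pderiv F j))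
  have i2 : Integrable F := hF.continuous.integrable_of_hasCompactSupport hc
  have h := integral_mul_fderiv_eq_neg_fderiv_mul_of_integrable (μ := volume)
    (f := fun _ : Euc d => (1 : ℂ)) (g := F) (v := EuclideanSpace.single j 1) (by simp)
    (by simpa [pderiv] using i1) (by simpa using i2) (fun x _ => differentiableAt_const _)
    (fun x _ => hF.differentiable (by simp) x)
  simpa [pderiv] using h

theorem setIntegral_pderiv_eq_zero {F : Euc d → ℂ} (hF : ContDiff ℝ 1 F)
    (hc : HasCompactSupport F) (hs : tsupport F ⊆ Ω) (j : Fin d) :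
    ∫ x in Ω, pderiv j F x = 0 := by
  rw [setIntegral_eq_integral_of_forall_compl_eq_zero fun x hx =>
    image_eq_zero_of_notMem_tsupport fun h => hx (hs (tsupport_pderiv F j h))]
  exact integral_pderiv_eq_zero hF hc j

theorem pderiv_ofReal {f : Euc d → ℝ} {x : Euc d} (hf : DifferentiableAt ℝ f x) (j : Fin d) :
    pderiv j (fun y => (f y : ℂ)) x = ((pderiv j f x : ℝ) : ℂ) := by
  have h := Complex.ofRealCLM.hasFDerivAt.comp x hf.hasFDerivAt
  rw [pderiv, HasFDerivAt.fderiv (f := fun y => (f y : ℂ)) h]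
  rfl

theorem pderiv_conj {f : Euc d → ℂ} {x : Euc d} (hf : DifferentiableAt ℝ f x) (j : Fin d) :
    pderiv j (fun y => conj (f y)) x = conj (pderiv j f x) := by
  have h := Complex.conjCLE.toContinuousLinearMap.hasFDerivAt.comp x hf.hasFDerivAt
  rw [pderiv, HasFDerivAt.fderiv (f := fun y => conj (f y)) h]
  rfl

theorem pderiv_comm {φ : Euc d → ℂ} (hφ : ContDiff ℝ ∞ φ) (j k : Fin d) (x : Euc d) :
    pderiv j (pderiv k φ) x = pderiv k (pderiv j φ) x := by
  have h2 : ContDiff ℝ 2 φ := contDiff_infty.1 hφ 2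
  have hd : DifferentiableAt ℝ (fderiv ℝ φ) x :=
    (h2.fderiv_right (m := 1) (by norm_num)).differentiable (by simp) x
  have key : ∀ a b : Fin d, pderiv a (pderiv b φ) x =
      fderiv ℝ (fderiv ℝ φ) x (EuclideanSpace.single a 1) (EuclideanSpace.single b 1) := by
    intro a b
    have h := hd.hasFDerivAt.clm_apply
      (hasFDerivAt_const (EuclideanSpace.single b (1 : ℝ) : Euc d) x)
    rw [pderiv, HasFDerivAt.fderiv (f := pderiv b φ) h]
    simp
  rw [key, key]
  exact (h2.contDiffAt.isSymmSndFDerivAt (by simp [minSmoothness_of_isRCLikeNormedField])).eq _ _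

theorem contDiffOn_coord {n : WithTop ℕ∞} (hA : ContDiffOn ℝ n A Ω) (k : Fin d) :
    ContDiffOn ℝ n (fun x => A x k) Ω :=
  (EuclideanSpace.proj k : Euc d →L[ℝ] ℝ).contDiff.comp_contDiffOn hA

theorem IsTest.contDiffOn_magP (hA : ContDiffOn ℝ 1 A Ω) {φ : Euc d → ℂ} (hφ : IsTest Ω φ)
    (k : Fin d) : ContDiffOn ℝ 1 (magP A k φ) Ω := by
  have h2 : ContDiff ℝ 2 φ := contDiff_infty.1 hφ.smooth 2
  have h1 : ContDiff ℝ 1 (pderiv k φ) :=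
    (h2.fderiv_right (m := 1) (by norm_num)).clm_apply contDiff_const
  have h3 : ContDiffOn ℝ 1 (fun x => (A x k : ℂ)) Ω :=
    Complex.ofRealCLM.contDiff.comp_contDiffOn (contDiffOn_coord hA k)
  exact (contDiffOn_const.mul h1.contDiffOn).add
    (h3.mul (h2.of_le (by norm_num)).contDiffOn)

theorem pderiv_magP (hΩ : IsOpen Ω) (hA : ContDiffOn ℝ 1 A Ω) {φ : Euc d → ℂ} (hφ : IsTest Ω φ)
    (j k : Fin d) {x : Euc d} (hx : x ∈ Ω) :
    pderiv j (magP A k φ) x = -Complex.I * pderiv j (pderiv k φ) x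
      + ((A x k : ℂ) * pderiv j φ x + ((pderiv j (fun y => A y k) x : ℝ) : ℂ) * φ x) := by
  have h2 : ContDiff ℝ 2 φ := contDiff_infty.1 hφ.smooth 2
  have h1 : DifferentiableAt ℝ (pderiv k φ) x :=
    ((h2.fderiv_right (m := 1) (by norm_num)).clm_apply contDiff_const).differentiable
      (by simp) x
  have hA' : DifferentiableAt ℝ (fun y => A y k) x :=
    ((contDiffOn_coord hA k).differentiableOn (by simp)).differentiableAt (hΩ.mem_nhds hx)
  have h3 : DifferentiableAt ℝ (fun y => (A y k : ℂ)) x :=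
    Complex.ofRealCLM.differentiableAt.comp x hA'
  have h4 : DifferentiableAt ℝ φ x := h2.differentiable (by simp) x
  have e : pderiv j (magP A k φ) x = pderiv j (fun y => -Complex.I * pderiv k φ y) x
      + pderiv j (fun y => (A y k : ℂ) * φ y) x := by
    have h := (h1.const_mul (-Complex.I)).hasFDerivAt.add (h3.mul h4).hasFDerivAt
    rw [pderiv, HasFDerivAt.fderiv (f := magP A k φ) h]
    rfl
  rw [e, pderiv_mul (differentiableAt_const _) h1, pderiv_mul h3 h4, pderiv_ofReal hA']
  simp [pderiv]

/-- The commutator formula `[P_j, P_k] = -i B_{jk}`, tested against `w u` for a real multiplier `w`. -/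
theorem magGraph_commutator (hΩ : IsOpen Ω) (hA : ContDiffOn ℝ 1 A Ω) {w : Euc d → ℝ}
    (hw : IsMultiplier Ω fun x => (w x : ℂ)) {j k : Fin d}
    (hwB : BddOn Ω fun x => ((w x * magB A j k x : ℝ) : ℂ))
    {p : L2 Ω × (Fin d → L2 Ω)} (hp : p ∈ magGraph Ω A) :
    inner ℂ (mulOp hΩ hw.bddOn (p.2 j) - Complex.I • mulOp hΩ (hw.bddOn_pderiv j) p.1) (p.2 k)
      - inner ℂ (mulOp hΩ hw.bddOn (p.2 k) - Complex.I • mulOp hΩ (hw.bddOn_pderiv k) p.1) (p.2 j)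
      + Complex.I * inner ℂ p.1 (mulOp hΩ hwB p.1) = 0 := by
  refine closure_minimal (t := {p : L2 Ω × (Fin d → L2 Ω) |
    inner ℂ (mulOp hΩ hw.bddOn (p.2 j) - Complex.I • mulOp hΩ (hw.bddOn_pderiv j) p.1) (p.2 k)
      - inner ℂ (mulOp hΩ hw.bddOn (p.2 k) - Complex.I • mulOp hΩ (hw.bddOn_pderiv k) p.1) (p.2 j)
      + Complex.I * inner ℂ p.1 (mulOp hΩ hwB p.1) = 0}) ?_ ?_ hp
  swap
  · exact isClosed_eq (by fun_prop) continuous_const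
  rintro p ⟨φ, hφ, h1, h2⟩
  have hφ1 : ContDiff ℝ 1 φ := hφ.smooth.of_le (by exact_mod_cast le_top)
  have hφc : ContDiff ℝ 1 (fun x => conj (φ x)) := Complex.conjCLE.contDiff.comp hφ1
  have htc : tsupport (fun x => conj (φ x)) ⊆ tsupport φ :=
    closure_mono fun x (hx : conj (φ x) ≠ 0) (h0 : φ x = 0) => hx (by simp [h0])
  -- With `F_k = w (P_k φ) φ̄`, the integrand is exactly the total derivative `i ∂_j F_k - i ∂_k
  -- F_j`: moving `P_j` and `P_k` across leaves `w φ̄ [P_j, P_k] φ = -i w B_jk |φ|²`, which the last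
  -- term cancels, and the second derivatives of `φ` disappear by symmetry.
  let F : Fin d → Euc d → ℂ := fun k x => (w x : ℂ) * (magP A k φ x * conj (φ x))
  have hFs : ∀ k, tsupport (F k) ⊆ tsupport φ := fun k =>
    (tsupport_mul_subset_right.trans tsupport_mul_subset_right).trans htc
  have hFd : ∀ k, ContDiff ℝ 1 (F k) := fun k => contDiff_of_tsupport_subset hΩ
    (hw.contDiffOn.mul ((hφ.contDiffOn_magP hA k).mul hφc.contDiffOn)) ((hFs k).trans hφ.supp)
  have hFc : ∀ k, HasCompactSupport (F k) := fun k =>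
    IsCompact.of_isClosed_subset hφ.compact (isClosed_tsupport _) (hFs k)
  have hF0 : ∀ a b, ∫ x in Ω, pderiv a (F b) x = 0 := fun a b =>
    setIntegral_pderiv_eq_zero (hFd b) (hFc b) ((hFs b).trans hφ.supp) a
  have hFi : ∀ a b, IntegrableOn (fun x => pderiv a (F b) x) Ω := fun a b =>
    ((((hFd b).continuous_fderiv (by simp)).clm_apply
      continuous_const).integrable_of_hasCompactSupport
      (IsCompact.of_isClosed_subset (hFc b) (isClosed_tsupport _)
        (tsupport_pderiv (F b) a))).integrableOn
  rw [Set.mem_ofPred_eq]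
  simp only [MeasureTheory.L2.inner_def]
  rw [← integral_sub (MeasureTheory.L2.integrable_inner _ _)
    (MeasureTheory.L2.integrable_inner _ _), ← integral_const_mul,
    ← integral_add]
  rotate_left
  · exact (MeasureTheory.L2.integrable_inner _ _).sub (MeasureTheory.L2.integrable_inner _ _)
  · exact (MeasureTheory.L2.integrable_inner _ _).const_mul _
  have hzero : ∫ x in Ω, (Complex.I * pderiv j (F k) x - Complex.I * pderiv k (F j) x) = 0 := by
    rw [integral_sub ((hFi j k).const_mul _) ((hFi k j).const_mul _), integral_const_mul,
      integral_const_mul, hF0, hF0]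
    simp
  rw [← hzero]
  refine integral_congr_ae ?_
  filter_upwards [mulOp_coeFn hΩ hw.bddOn (p.2 j), mulOp_coeFn hΩ hw.bddOn (p.2 k),
    mulOp_coeFn hΩ (hw.bddOn_pderiv j) p.1, mulOp_coeFn hΩ (hw.bddOn_pderiv k) p.1,
    mulOp_coeFn hΩ hwB p.1, h1, h2 j, h2 k,
    Lp.coeFn_sub (mulOp hΩ hw.bddOn (p.2 j)) (Complex.I • mulOp hΩ (hw.bddOn_pderiv j) p.1),
    Lp.coeFn_sub (mulOp hΩ hw.bddOn (p.2 k)) (Complex.I • mulOp hΩ (hw.bddOn_pderiv k) p.1),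
    Lp.coeFn_smul Complex.I (mulOp hΩ (hw.bddOn_pderiv j) p.1),
    Lp.coeFn_smul Complex.I (mulOp hΩ (hw.bddOn_pderiv k) p.1),
    ae_restrict_mem hΩ.measurableSet] with x a1 a2 a3 a4 a5 b1 b2 b3 c1 c2 c3 c4 hx
  have hwd : DifferentiableAt ℝ (fun x => (w x : ℂ)) x :=
    (hw.contDiffOn.differentiableOn (by simp)).differentiableAt (hΩ.mem_nhds hx)
  have hwr : DifferentiableAt ℝ w x := Complex.reCLM.differentiableAt.comp x hwd
  have hφd : DifferentiableAt ℝ φ x := hφ1.differentiable (by simp) x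
  have hφcd : DifferentiableAt ℝ (fun x => conj (φ x)) x := hφc.differentiable (by simp) x
  have hPd : ∀ k, DifferentiableAt ℝ (magP A k φ) x := fun k =>
    ((hφ.contDiffOn_magP hA k).differentiableOn (by simp)).differentiableAt (hΩ.mem_nhds hx)
  have hFder : ∀ a b, pderiv a (F b) x = (w x : ℂ) *
      (magP A b φ x * conj (pderiv a φ x) + (-Complex.I * pderiv a (pderiv b φ) x
      + ((A x b : ℂ) * pderiv a φ x + ((pderiv a (fun y => A y b) x : ℝ) : ℂ) * φ x)) * conj (φ x))
      + ((pderiv a w x : ℝ) : ℂ) * (magP A b φ x * conj (φ x)) := fun a b => by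
    refine (pderiv_mul (g := fun y => magP A b φ y * conj (φ y)) hwd
      ((hPd b).mul hφcd) a).trans ?_
    rw [pderiv_mul (hPd b) hφcd, pderiv_conj hφd,
      pderiv_ofReal hwr, pderiv_magP hΩ hA hφ a b hx]
  simp only [RCLike.inner_apply, c1, c2, Pi.sub_apply, c3, c4, Pi.smul_apply, a1, a2, a3, a4, a5,
    b1, b2, b3]
  simp only [hFder, pderiv_ofReal hwr, pderiv_comm hφ.smooth k j x, magP, magB, map_sub, map_mul,
    map_add, map_neg, Complex.conj_I, Complex.conj_ofReal, smul_eq_mul, Complex.ofReal_mul,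
    Complex.ofReal_sub]
  ring_nf

end Commutator

/-! ### Elementary bounds for the weight, and the hypotheses in global form. -/

section Weights

variable {d : ℕ} {Ω : Set (Euc d)} {A : Euc d → Euc d} {V : Euc d → ℂ}

/-- `|∇V| + |∇B|`. -/
noncomputable def gradSize {d : ℕ} (A : Euc d → Euc d) (V : Euc d → ℂ) (x : Euc d) : ℝ :=
  normGradV V x + normGradB A x

/-- The global form of the assumptions on the electric potential and the magnetic field. -/
structure Admissible {d : ℕ} (Ω : Set (Euc d)) (A : Euc d → Euc d) (V : Euc d → ℂ) : Prop where
  isOpen : IsOpen Ω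
  contDiffOn_A : ContDiffOn ℝ 2 A Ω
  contDiffOn_V : ContDiffOn ℝ 1 V Ω
  gradSize_le : ∀ ε : ℝ, 0 < ε → ∃ C : ℝ, 0 ≤ C ∧ ∀ x ∈ Ω,
    gradSize A V x ≤ ε * (weight A V x * √(weight A V x)) + C
  neg_re_le : ∀ ε : ℝ, 0 < ε → ∃ C : ℝ, 0 ≤ C ∧ ∀ x ∈ Ω, -(V x).re ≤ ε * weight A V x + C

theorem weight_sq (x : Euc d) : weight A V x ^ 2 = 1 + normB A x ^ 2 + ‖V x‖ ^ 2 :=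
  Real.sq_sqrt (by positivity)

theorem normB_sq (x : Euc d) : normB A x ^ 2 = ∑ j, ∑ k, magB A j k x ^ 2 :=
  Real.sq_sqrt (Finset.sum_nonneg fun _ _ => Finset.sum_nonneg fun _ _ => sq_nonneg _)

theorem one_le_weight (x : Euc d) : 1 ≤ weight A V x := by
  rw [weight, Real.one_le_sqrt]
  nlinarith [sq_nonneg (normB A x), sq_nonneg ‖V x‖]

theorem weight_pos (x : Euc d) : 0 < weight A V x := zero_lt_one.trans_le (one_le_weight x)

theorem norm_le_weight (x : Euc d) : ‖V x‖ ≤ weight A V x := by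
  refine Real.le_sqrt_of_sq_le ?_
  nlinarith [sq_nonneg (normB A x)]

theorem normB_le_weight (x : Euc d) : normB A x ≤ weight A V x := by
  refine Real.le_sqrt_of_sq_le ?_
  nlinarith [sq_nonneg ‖V x‖]

theorem abs_le_sqrt_sum_sum {ι κ : Type*} [Fintype ι] [Fintype κ] (f : ι → κ → ℝ) (j : ι) (k : κ) :
    |f j k| ≤ √(∑ j, ∑ k, f j k ^ 2) := by
  refine Real.abs_le_sqrt ?_
  exact (Finset.single_le_sum (f := fun k => f j k ^ 2) (fun _ _ => sq_nonneg _)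
    (Finset.mem_univ k)).trans (Finset.single_le_sum (f := fun j => ∑ k, f j k ^ 2)
      (fun _ _ => Finset.sum_nonneg fun _ _ => sq_nonneg _) (Finset.mem_univ j))

theorem abs_magB_le_weight (j k : Fin d) (x : Euc d) : |magB A j k x| ≤ weight A V x :=
  (abs_le_sqrt_sum_sum (fun j k => magB A j k x) j k).trans (normB_le_weight x)

theorem gradSize_nonneg (x : Euc d) : 0 ≤ gradSize A V x :=
  add_nonneg (Real.sqrt_nonneg _) (Real.sqrt_nonneg _)

theorem sqrt_sum_pderiv_magB_le (l : Fin d) (x : Euc d) :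
    √(∑ j, ∑ k, pderiv l (magB A j k) x ^ 2) ≤ normGradB A x := by
  refine Real.sqrt_le_sqrt (Finset.sum_le_sum fun j _ => Finset.sum_le_sum fun k _ => ?_)
  exact Finset.single_le_sum (f := fun l => pderiv l (magB A j k) x ^ 2)
    (fun _ _ => sq_nonneg _) (Finset.mem_univ l)

theorem norm_pderiv_le_normGradV (l : Fin d) (x : Euc d) : ‖pderiv l V x‖ ≤ normGradV V x := by
  refine Real.le_sqrt_of_sq_le ?_
  exact Finset.single_le_sum (f := fun l => ‖pderiv l V x‖ ^ 2) (fun _ _ => sq_nonneg _)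
    (Finset.mem_univ l)

theorem abs_pderiv_magB_le_gradSize (j k l : Fin d) (x : Euc d) :
    |pderiv l (magB A j k) x| ≤ gradSize A V x :=
  ((abs_le_sqrt_sum_sum (fun j k => pderiv l (magB A j k) x) j k).trans
    (sqrt_sum_pderiv_magB_le l x)).trans (le_add_of_nonneg_left (Real.sqrt_nonneg _))

theorem norm_pderiv_le_gradSize (l : Fin d) (x : Euc d) : ‖pderiv l V x‖ ≤ gradSize A V x :=
  (norm_pderiv_le_normGradV l x).trans (le_add_of_nonneg_right (Real.sqrt_nonneg _))

theorem pderiv_coord (hΩ : IsOpen Ω) (hA : ContDiffOn ℝ 1 A Ω) (j k : Fin d) {x : Euc d}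
    (hx : x ∈ Ω) : pderiv j (fun y => A y k) x = fderiv ℝ A x (EuclideanSpace.single j 1) k := by
  have h1 : DifferentiableAt ℝ A x :=
    (hA.differentiableOn (by simp)).differentiableAt (hΩ.mem_nhds hx)
  have h := (EuclideanSpace.proj k : Euc d →L[ℝ] ℝ).hasFDerivAt.comp x h1.hasFDerivAt
  rw [pderiv, HasFDerivAt.fderiv (f := fun y => A y k) h]
  rfl

theorem contDiffOn_magB (hΩ : IsOpen Ω) (hA : ContDiffOn ℝ 2 A Ω) (j k : Fin d) :
    ContDiffOn ℝ 1 (magB A j k) Ω := by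
  have h1 : ContDiffOn ℝ 1 (fderiv ℝ A) Ω := hA.fderiv_of_isOpen hΩ (by norm_num)
  have h2 : ∀ j k : Fin d, ContDiffOn ℝ 1 (pderiv j fun y => A y k) Ω := fun j k =>
    (contDiffOn_coord (h1.clm_apply contDiffOn_const) k).congr fun x hx =>
      pderiv_coord hΩ (hA.of_le (by norm_num)) j k hx
  exact (h2 j k).sub (h2 k j)

/-- Serves to bound `∇B` on bounded parts of `Ω` through the second derivative of `A`; the factor 2
counts the two terms of `B_jk`. -/
theorem abs_pderiv_magB_le (hΩ : IsOpen Ω) (hA : ContDiffOn ℝ 2 A Ω) (j k l : Fin d) {x : Euc d}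
    (hx : x ∈ Ω) : |pderiv l (magB A j k) x| ≤ 2 * ‖fderiv ℝ (fderiv ℝ A) x‖ := by
  have h1 : DifferentiableAt ℝ (fderiv ℝ A) x := ((hA.fderiv_of_isOpen (m := 1) hΩ
    (by norm_num)).differentiableOn (by simp)).differentiableAt (hΩ.mem_nhds hx)
  have h2 : ∀ j k : Fin d, HasFDerivAt (pderiv j fun y => A y k)
      ((EuclideanSpace.proj k : Euc d →L[ℝ] ℝ).comp
        ((fderiv ℝ (fderiv ℝ A) x).flip (EuclideanSpace.single j 1))) x := fun j k => by
    have h3 := h1.hasFDerivAt.clm_apply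
      (hasFDerivAt_const (EuclideanSpace.single j (1 : ℝ) : Euc d) x)
    have h4 := (EuclideanSpace.proj k : Euc d →L[ℝ] ℝ).hasFDerivAt.comp x h3
    refine (h4.congr_of_eventuallyEq ?_).congr_fderiv (by ext; simp)
    filter_upwards [hΩ.mem_nhds hx] with y hy
    exact pderiv_coord hΩ (hA.of_le (by norm_num)) j k hy
  have h5 : ∀ j k : Fin d, |fderiv ℝ (fderiv ℝ A) x (EuclideanSpace.single l 1)
      (EuclideanSpace.single j 1) k| ≤ ‖fderiv ℝ (fderiv ℝ A) x‖ := fun j k => by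
    refine (PiLp.norm_apply_le (fderiv ℝ (fderiv ℝ A) x (EuclideanSpace.single l 1)
      (EuclideanSpace.single j 1)) k).trans ?_
    simpa using (fderiv ℝ (fderiv ℝ A) x).le_opNorm₂ (EuclideanSpace.single l 1)
      (EuclideanSpace.single j 1)
  have h6 := (h2 j k).sub (h2 k j)
  rw [pderiv, HasFDerivAt.fderiv (f := magB A j k) h6]
  change |fderiv ℝ (fderiv ℝ A) x (EuclideanSpace.single l 1) (EuclideanSpace.single j 1) k -
    fderiv ℝ (fderiv ℝ A) x (EuclideanSpace.single l 1) (EuclideanSpace.single k 1) j| ≤ _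
  refine (abs_sub _ _).trans ?_
  rw [two_mul]
  exact add_le_add (h5 j k) (h5 k j)

/-- The closure of `Ω` meets a closed ball in a compact set, on which the continuous extension is
bounded. This is where regularity up to the closure enters. -/
theorem ContDiffClosure.exists_bound {F : Type*} [NormedAddCommGroup F] [NormedSpace ℝ F] {n : ℕ}
    {f : Euc d → F} (h : ContDiffClosure n f Ω) {k : ℕ} (hk : k ≤ n) (R : ℝ) :
    ∃ C : ℝ, ∀ x ∈ Ω, ‖x‖ ≤ R → ‖iteratedFDeriv ℝ k f x‖ ≤ C := by
  obtain ⟨G, hG, hGf⟩ := h.2 k hk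
  have hK : IsCompact (closure Ω ∩ Metric.closedBall (0 : Euc d) R) :=
    (isCompact_closedBall _ _).inter_left isClosed_closure
  obtain ⟨C, hC⟩ := hK.exists_bound_of_continuousOn (hG.mono Set.inter_subset_left)
  refine ⟨C, fun x hx hR => ?_⟩
  rw [← hGf hx]
  exact hC x ⟨subset_closure hx, by simpa using hR⟩

/-- Far away the asymptotic bound applies; on the remaining bounded part of `Ω` the local bound goes
into the additive constant. -/
theorem exists_le_of_isLittleO {f g : Euc d → ℝ}
    (h : f =o[Bornology.cobounded (Euc d) ⊓ 𝓟 Ω] g) (hg : ∀ x, 0 ≤ g x)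
    (hf : ∀ R : ℝ, ∃ C : ℝ, ∀ x ∈ Ω, ‖x‖ ≤ R → f x ≤ C) {ε : ℝ} (hε : 0 < ε) :
    ∃ C : ℝ, 0 ≤ C ∧ ∀ x ∈ Ω, f x ≤ ε * g x + C := by
  have h1 := h.bound hε
  rw [eventually_inf_principal, ← comap_norm_atTop, eventually_comap, eventually_atTop] at h1
  obtain ⟨R, hR⟩ := h1
  obtain ⟨C, hC⟩ := hf R
  refine ⟨max C 0, le_max_right _ _, fun x hx => ?_⟩
  rcases le_total ‖x‖ R with h2 | h2
  · have := mul_nonneg hε.le (hg x)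
    linarith [hC x hx h2, le_max_left C 0]
  · have := hR _ h2 x rfl hx
    rw [Real.norm_eq_abs, Real.norm_eq_abs, abs_of_nonneg (hg x)] at this
    linarith [le_abs_self (f x), le_max_right C 0]

/-- Turns the conditions at infinity into inequalities on all of `Ω`, so that no cutoff in space is
needed later. The power `m^{3/2}` becomes `m √m`, ready for the splitting `(√m |Pu|) (m |u|)`. -/
theorem admissible_of_isLittleO (hΩ : IsOpen Ω)
    (hV : ContDiffClosure 1 V Ω) (hA : ContDiffClosure 2 A Ω)
    (hgrad : (fun x => normGradV V x + normGradB A x)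
      =o[Bornology.cobounded (Euc d) ⊓ 𝓟 Ω] fun x => weight A V x ^ (3 / 2 : ℝ))
    (hneg : (fun x => max (-(V x).re) 0)
      =o[Bornology.cobounded (Euc d) ⊓ 𝓟 Ω] fun x => weight A V x) : Admissible Ω A V := by
  have hA2 : ContDiffOn ℝ 2 A Ω := by exact_mod_cast hA.1
  refine ⟨hΩ, hA2, by exact_mod_cast hV.1, fun ε hε => ?_, fun ε hε => ?_⟩
  · have e : ∀ x, weight A V x * √(weight A V x) = weight A V x ^ (3 / 2 : ℝ) := fun x => by
      rw [Real.sqrt_eq_rpow, ← Real.rpow_one_add' (weight_pos x).le (by norm_num)]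
      norm_num
    simp only [e]
    refine exists_le_of_isLittleO hgrad (fun x => Real.rpow_nonneg (weight_pos x).le _)
      (fun R => ?_) hε
    obtain ⟨C₁, h₁⟩ := hV.exists_bound le_rfl R
    obtain ⟨C₂, h₂⟩ := hA.exists_bound le_rfl R
    refine ⟨√(∑ _l : Fin d, C₁ ^ 2) + √(∑ _j : Fin d, ∑ _k : Fin d, ∑ _l : Fin d, (2 * C₂) ^ 2),
      fun x hx hR => add_le_add (Real.sqrt_le_sqrt (Finset.sum_le_sum fun l _ => ?_))
        (Real.sqrt_le_sqrt (Finset.sum_le_sum fun j _ => Finset.sum_le_sum fun k _ =>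
          Finset.sum_le_sum fun l _ => ?_))⟩
    · refine pow_le_pow_left₀ (norm_nonneg _) (le_trans ?_ (h₁ x hx hR)) 2
      rw [norm_iteratedFDeriv_one]
      simpa [pderiv] using (fderiv ℝ V x).le_opNorm (EuclideanSpace.single l 1)
    · rw [← sq_abs]
      refine pow_le_pow_left₀ (abs_nonneg _) ((abs_pderiv_magB_le hΩ hA2 j k l hx).trans ?_) 2
      have h3 := h₂ x hx hR
      rw [← norm_iteratedFDeriv_fderiv, norm_iteratedFDeriv_one] at h3
      linarith
  · obtain ⟨C, hC, h⟩ := exists_le_of_isLittleO hneg (fun x => (weight_pos x).le) (fun R => by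
      obtain ⟨C, hC⟩ := hV.exists_bound (Nat.zero_le 1) R
      refine ⟨C, fun x hx hR => le_trans ?_ (hC x hx hR)⟩
      rw [norm_iteratedFDeriv_zero]
      exact max_le ((neg_le_abs _).trans (Complex.abs_re_le_norm _)) (norm_nonneg _)) hε
    exact ⟨C, hC, fun x hx => (le_max_left _ _).trans (h x hx)⟩

end Weights

/-! ### The damping factor and the damped symbols. -/

section Damping

variable {d : ℕ} {Ω : Set (Euc d)} {A : Euc d → Euc d} {V : Euc d → ℂ}

theorem Admissible.contDiffOn_magB (h : Admissible Ω A V) (j k : Fin d) :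
    ContDiffOn ℝ 1 (magB A j k) Ω :=
  MagneticSchrodinger.contDiffOn_magB h.isOpen h.contDiffOn_A j k

theorem Admissible.continuousOn_A (h : Admissible Ω A V) : ContinuousOn A Ω :=
  h.contDiffOn_A.continuousOn

theorem Admissible.contDiffOn_weight_sq (h : Admissible Ω A V) :
    ContDiffOn ℝ 1 (fun x => weight A V x ^ 2) Ω := by
  simp only [weight_sq, normB_sq]
  exact (contDiffOn_const.add (ContDiffOn.sum fun j _ => ContDiffOn.sum fun k _ =>
    (h.contDiffOn_magB j k).pow 2)).add (h.contDiffOn_V.norm_sq ℝ)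

theorem Admissible.contDiffOn_weight (h : Admissible Ω A V) :
    ContDiffOn ℝ 1 (weight A V) Ω := by
  refine (h.contDiffOn_weight_sq.sqrt fun x _ => (pow_pos (weight_pos x) 2).ne').congr
    fun x _ => (Real.sqrt_sq (weight_pos x).le).symm

theorem differentiableAt_of_contDiffOn {F : Type*} [NormedAddCommGroup F] [NormedSpace ℝ F]
    {f : Euc d → F} (hΩ : IsOpen Ω) (hf : ContDiffOn ℝ 1 f Ω) {x : Euc d} (hx : x ∈ Ω) :
    DifferentiableAt ℝ f x :=
  (hf.differentiableOn (by simp)).differentiableAt (hΩ.mem_nhds hx)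

theorem sum_sum_mul_le_sqrt_mul_sqrt {ι κ : Type*} [Fintype ι] [Fintype κ] (f g : ι → κ → ℝ) :
    |∑ j, ∑ k, f j k * g j k| ≤ √(∑ j, ∑ k, f j k ^ 2) * √(∑ j, ∑ k, g j k ^ 2) := by
  simp only [← Fintype.sum_prod_type']
  refine abs_le.2 ⟨?_, Real.sum_mul_le_sqrt_mul_sqrt _ _ _⟩
  have h := Real.sum_mul_le_sqrt_mul_sqrt Finset.univ (fun p : ι × κ => -f p.1 p.2)
    fun p => g p.1 p.2
  simp only [neg_mul, Finset.sum_neg_distrib, neg_sq] at h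
  linarith

/-- Cauchy–Schwarz in `∂_l m² = 2 ∑ B_jk ∂_l B_jk + 2 Re (V̄ ∂_l V)`, with `|B|` and `|V|` at most
`m`. -/
theorem Admissible.abs_pderiv_weight_sq_le (h : Admissible Ω A V) (l : Fin d) {x : Euc d}
    (hx : x ∈ Ω) :
    |pderiv l (fun x => weight A V x ^ 2) x| ≤ 2 * weight A V x * gradSize A V x := by
  have hB : ∀ j k, HasFDerivAt (fun x => magB A j k x * magB A j k x) _ x := fun j k =>
    let H := (differentiableAt_of_contDiffOn h.isOpen (h.contDiffOn_magB j k) hx).hasFDerivAt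
    H.mul H
  have hV := (differentiableAt_of_contDiffOn h.isOpen h.contDiffOn_V hx).hasFDerivAt.norm_sq
  have hM := ((hasFDerivAt_const (1 : ℝ) x).add (HasFDerivAt.fun_sum fun j (_ : j ∈ Finset.univ) =>
    HasFDerivAt.fun_sum fun k (_ : k ∈ Finset.univ) => hB j k)).add hV
  have e : (fun x => weight A V x ^ 2) = fun x =>
      1 + (∑ j, ∑ k, magB A j k x * magB A j k x) + ‖V x‖ ^ 2 := by
    ext y
    simp only [weight_sq, normB_sq, sq (magB A _ _ y)]
  have e2 : pderiv l (fun x => weight A V x ^ 2) x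
      = 2 * (∑ j, ∑ k, magB A j k x * pderiv l (magB A j k) x) +
        2 * inner ℝ (V x) (pderiv l V x) := by
    rw [e, pderiv, HasFDerivAt.fderiv (f := fun x =>
      1 + (∑ j, ∑ k, magB A j k x * magB A j k x) + ‖V x‖ ^ 2) hM]
    simp only [Finset.mul_sum]
    simp [pderiv, sum_apply, two_mul]
    ring
  have h1 := sum_sum_mul_le_sqrt_mul_sqrt (fun j k => magB A j k x)
    fun j k => pderiv l (magB A j k) x
  have h2 : |inner ℝ (V x) (pderiv l V x)| ≤ ‖V x‖ * ‖pderiv l V x‖ := abs_real_inner_le_norm _ _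
  have h3 : √(∑ j, ∑ k, magB A j k x ^ 2) * √(∑ j, ∑ k, pderiv l (magB A j k) x ^ 2)
      ≤ weight A V x * normGradB A x :=
    mul_le_mul (normB_le_weight x) (sqrt_sum_pderiv_magB_le l x) (Real.sqrt_nonneg _)
      (weight_pos x).le
  have h4 : ‖V x‖ * ‖pderiv l V x‖ ≤ weight A V x * normGradV V x :=
    mul_le_mul (norm_le_weight x) (norm_pderiv_le_normGradV l x) (norm_nonneg _) (weight_pos x).le
  rw [e2]
  refine (abs_add_le _ _).trans ?_
  rw [abs_mul, abs_mul, abs_two, gradSize]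
  nlinarith

theorem Admissible.abs_pderiv_weight_le (h : Admissible Ω A V) (l : Fin d) {x : Euc d}
    (hx : x ∈ Ω) : |pderiv l (weight A V) x| ≤ gradSize A V x := by
  have hd := (differentiableAt_of_contDiffOn h.isOpen h.contDiffOn_weight hx).hasFDerivAt
  have h2 := hd.mul hd
  have e : (fun x => weight A V x ^ 2) = weight A V * weight A V := by
    ext y
    simp [sq]
  have h3 : pderiv l (fun x => weight A V x ^ 2) x
      = 2 * weight A V x * pderiv l (weight A V) x := by
    rw [pderiv, e, h2.fderiv]
    simp [pderiv]
    ring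
  have h4 := h.abs_pderiv_weight_sq_le l hx
  have h5 : (0 : ℝ) < 2 * weight A V x := by linarith [weight_pos (A := A) (V := V) x]
  rw [h3, abs_mul, abs_of_pos h5] at h4
  exact le_of_mul_le_mul_left h4 h5

/-- The squared damping factor `(1 + s m²)⁻²`. -/
noncomputable def damp {d : ℕ} (A : Euc d → Euc d) (V : Euc d → ℂ) (s : ℝ) (x : Euc d) : ℝ :=
  ((1 + s * weight A V x ^ 2) ^ 2)⁻¹

variable {s : ℝ}

theorem one_le_dampDen (hs : 0 < s) (x : Euc d) : 1 ≤ 1 + s * weight A V x ^ 2 := by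
  have := mul_nonneg hs.le (sq_nonneg (weight A V x))
  linarith

theorem damp_pos (hs : 0 < s) (x : Euc d) : 0 < damp A V s x :=
  inv_pos.2 (pow_pos (zero_lt_one.trans_le (one_le_dampDen hs x)) 2)

theorem damp_le_one (hs : 0 < s) (x : Euc d) : damp A V s x ≤ 1 :=
  inv_le_one_of_one_le₀ (one_le_pow₀ (one_le_dampDen hs x))

theorem damp_mul_weight_sq_le (hs : 0 < s) (x : Euc d) :
    damp A V s x * weight A V x ^ 2 ≤ 1 / s := by
  have h1 := one_le_dampDen (A := A) (V := V) hs x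
  rw [damp, inv_mul_eq_div, div_le_div_iff₀ (by positivity) hs]
  nlinarith

theorem Admissible.contDiffOn_damp (h : Admissible Ω A V) (hs : 0 < s) :
    ContDiffOn ℝ 1 (damp A V s) Ω :=
  ((contDiffOn_const.add (contDiffOn_const.mul h.contDiffOn_weight_sq)).pow 2).inv fun x _ =>
    (pow_pos (zero_lt_one.trans_le (one_le_dampDen hs x)) 2).ne'

/-- With `N = 1 + s m²`, the logarithmic derivative of `damp` is `-2 s ∂_l(m²) / N`. Times `m` it is
at most `4 gradSize · s m² / N`, and `s m² ≤ N` removes every trace of `s`. -/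
theorem Admissible.abs_pderiv_damp_le (h : Admissible Ω A V) (hs : 0 < s) (l : Fin d) {x : Euc d}
    (hx : x ∈ Ω) :
    |pderiv l (damp A V s) x| * weight A V x ≤ 4 * (damp A V s x * gradSize A V x) := by
  have hM := (differentiableAt_of_contDiffOn h.isOpen h.contDiffOn_weight_sq hx).hasFDerivAt
  set N := 1 + s * weight A V x ^ 2 with hN
  have hN1 : 1 ≤ N := one_le_dampDen hs x
  have hN0 : 0 < N := zero_lt_one.trans_le hN1
  have h1 : HasDerivAt (fun t : ℝ => ((1 + s * t) ^ 2)⁻¹) (-(2 * N * s) / (N ^ 2) ^ 2)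
      (weight A V x ^ 2) := by
    have h2 : HasDerivAt (fun t : ℝ => (1 + s * t) ^ 2) (2 * N * s) (weight A V x ^ 2) := by
      have := (((hasDerivAt_id (weight A V x ^ 2)).const_mul s).const_add 1).pow 2
      refine HasDerivAt.congr_deriv this ?_
      simp [hN]
    exact h2.inv (by positivity)
  have h3 := h1.comp_hasFDerivAt x hM
  have h4 : pderiv l (damp A V s) x
      = -(2 * N * s) / (N ^ 2) ^ 2 * pderiv l (fun x => weight A V x ^ 2) x := by
    rw [pderiv, HasFDerivAt.fderiv (f := damp A V s) h3]
    rfl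
  have h5 := h.abs_pderiv_weight_sq_le l hx
  have hG := gradSize_nonneg (A := A) (V := V) x
  have hm := weight_pos (A := A) (V := V) x
  have hd : damp A V s x = (N ^ 2)⁻¹ := rfl
  rw [h4, abs_mul, neg_div, abs_neg, abs_of_pos (by positivity), hd]
  calc 2 * N * s / (N ^ 2) ^ 2 * |pderiv l (fun x => weight A V x ^ 2) x| * weight A V x
      ≤ 2 * N * s / (N ^ 2) ^ 2 * (2 * weight A V x * gradSize A V x) * weight A V x := by
        gcongr
    _ = 4 * ((N ^ 2)⁻¹ * gradSize A V x) * ((s * weight A V x ^ 2) / N) := by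
        field_simp
        ring
    _ ≤ 4 * ((N ^ 2)⁻¹ * gradSize A V x) * 1 := by
        gcongr
        rw [div_le_one hN0, hN]
        linarith
    _ = _ := mul_one _

/-- A `C¹` function that is bounded, together with its gradient, by the weight `m` and by
`|∇V| + |∇B|`, respectively. -/
structure IsSymbol {d : ℕ} (Ω : Set (Euc d)) (A : Euc d → Euc d) (V F : Euc d → ℂ) : Prop where
  contDiffOn : ContDiffOn ℝ 1 F Ω
  norm_le : ∀ x ∈ Ω, ‖F x‖ ≤ weight A V x
  norm_pderiv_le : ∀ l, ∀ x ∈ Ω, ‖pderiv l F x‖ ≤ gradSize A V x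

theorem Admissible.isSymbol_potential (h : Admissible Ω A V) : IsSymbol Ω A V V :=
  ⟨h.contDiffOn_V, fun x _ => norm_le_weight x, fun l x _ => norm_pderiv_le_gradSize l x⟩

theorem Admissible.isSymbol_weight (h : Admissible Ω A V) :
    IsSymbol Ω A V fun x => (weight A V x : ℂ) := by
  refine ⟨Complex.ofRealCLM.contDiff.comp_contDiffOn h.contDiffOn_weight, fun x _ => ?_,
    fun l x hx => ?_⟩
  · rw [Complex.norm_real, Real.norm_eq_abs, abs_of_pos (weight_pos x)]
  · rw [pderiv_ofReal (differentiableAt_of_contDiffOn h.isOpen h.contDiffOn_weight hx),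
      Complex.norm_real]
    exact h.abs_pderiv_weight_le l hx

theorem Admissible.isSymbol_magB (h : Admissible Ω A V) (j k : Fin d) :
    IsSymbol Ω A V fun x => (magB A j k x : ℂ) := by
  refine ⟨Complex.ofRealCLM.contDiff.comp_contDiffOn (h.contDiffOn_magB j k), fun x _ => ?_,
    fun l x hx => ?_⟩
  · rw [Complex.norm_real]
    exact abs_magB_le_weight j k x
  · rw [pderiv_ofReal (differentiableAt_of_contDiffOn h.isOpen (h.contDiffOn_magB j k) hx),
      Complex.norm_real]
    exact abs_pderiv_magB_le_gradSize j k l x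

/-- The damped symbol `(1 + s m²)⁻² F`. -/
noncomputable def dampMul {d : ℕ} (A : Euc d → Euc d) (V : Euc d → ℂ) (s : ℝ) (F : Euc d → ℂ)
    (x : Euc d) : ℂ :=
  (damp A V s x : ℂ) * F x

theorem IsSymbol.norm_dampMul_le (hs : 0 < s) {F : Euc d → ℂ} (hF : IsSymbol Ω A V F)
    {x : Euc d} (hx : x ∈ Ω) : ‖dampMul A V s F x‖ ≤ damp A V s x * weight A V x := by
  rw [dampMul, norm_mul, Complex.norm_real, Real.norm_eq_abs, abs_of_pos (damp_pos hs x)]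
  exact mul_le_mul_of_nonneg_left (hF.norm_le x hx) (damp_pos hs x).le

/-- The constant 5 is 1 for the derivative on `F` plus 4 for the derivative on `damp`, where `|F| ≤
m` is used. Independence of `s` is what makes the a priori estimate uniform. -/
theorem IsSymbol.norm_pderiv_dampMul_le (h : Admissible Ω A V) (hs : 0 < s) {F : Euc d → ℂ}
    (hF : IsSymbol Ω A V F) (l : Fin d) {x : Euc d} (hx : x ∈ Ω) :
    ‖pderiv l (dampMul A V s F) x‖ ≤ 5 * (damp A V s x * gradSize A V x) := by
  have hd := differentiableAt_of_contDiffOn h.isOpen (h.contDiffOn_damp hs) hx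
  have h1 : pderiv l (dampMul A V s F) x = (damp A V s x : ℂ) * pderiv l F x
      + ((pderiv l (damp A V s) x : ℝ) : ℂ) * F x := by
    rw [← pderiv_ofReal hd]
    exact pderiv_mul (Complex.ofRealCLM.differentiableAt.comp x hd)
      (differentiableAt_of_contDiffOn h.isOpen hF.contDiffOn hx) l
  rw [h1]
  refine (norm_add_le _ _).trans ?_
  rw [norm_mul, norm_mul, Complex.norm_real, Complex.norm_real, Real.norm_eq_abs,
    Real.norm_eq_abs, abs_of_pos (damp_pos hs x)]
  have h2 := mul_le_mul_of_nonneg_left (hF.norm_pderiv_le l x hx)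
    (damp_pos (A := A) (V := V) hs x).le
  have h3 := mul_le_mul_of_nonneg_left (hF.norm_le x hx) (abs_nonneg (pderiv l (damp A V s) x))
  linarith [h.abs_pderiv_damp_le hs l hx]

theorem damp_mul_weight_le (hs : 0 < s) (x : Euc d) : damp A V s x * weight A V x ≤ 1 / s := by
  refine le_trans (mul_le_mul_of_nonneg_left ?_ (damp_pos hs x).le) (damp_mul_weight_sq_le hs x)
  nlinarith [one_le_weight (A := A) (V := V) x]

theorem weight_mul_sqrt_le (x : Euc d) : weight A V x * √(weight A V x) ≤ weight A V x ^ 2 := by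
  rw [sq]
  refine mul_le_mul_of_nonneg_left ?_ (weight_pos x).le
  refine Real.sqrt_le_iff.2 ⟨(weight_pos x).le, ?_⟩
  nlinarith [one_le_weight (A := A) (V := V) x]

/-- The gradient is bounded because `m^{3/2} ≤ m²` and `damp · m² ≤ 1/s`. The bounds blow up as `s →
0`; only their finiteness is used. -/
theorem IsSymbol.isMultiplier (h : Admissible Ω A V) (hs : 0 < s) {F : Euc d → ℂ}
    (hF : IsSymbol Ω A V F) : IsMultiplier Ω (dampMul A V s F) := by
  have hc : ContDiffOn ℝ 1 (dampMul A V s F) Ω :=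
    (Complex.ofRealCLM.contDiff.comp_contDiffOn (h.contDiffOn_damp hs)).mul hF.contDiffOn
  refine ⟨hc, ⟨hc.continuousOn, 1 / s, fun x hx =>
    (hF.norm_dampMul_le hs hx).trans (damp_mul_weight_le hs x)⟩, fun l => ⟨?_, ?_⟩⟩
  · exact (hc.continuousOn_fderiv_of_isOpen h.isOpen le_rfl).clm_apply continuousOn_const
  · obtain ⟨C, hC, hG⟩ := h.gradSize_le 1 one_pos
    refine ⟨5 * (1 / s + C), fun x hx => (hF.norm_pderiv_dampMul_le h hs l hx).trans ?_⟩
    refine mul_le_mul_of_nonneg_left ?_ (by norm_num)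
    have h1 := damp_pos (A := A) (V := V) hs x
    have h2 := mul_le_mul_of_nonneg_left (hG x hx) h1.le
    have h3 := mul_le_mul_of_nonneg_left (weight_mul_sqrt_le (A := A) (V := V) x) h1.le
    have h4 := damp_mul_weight_sq_le (A := A) (V := V) hs x
    have h5 := mul_le_mul_of_nonneg_right (damp_le_one (A := A) (V := V) hs x) hC
    linarith

/-- The terms with a derivative on the weight are lower order terms. -/
theorem Admissible.exists_sum_gradSize_le (h : Admissible Ω A V) {ε : ℝ} (hε : 0 < ε) :
    ∃ C : ℝ, 0 ≤ C ∧ ∀ x ∈ Ω, ∀ t U : ℝ, ∀ q : Fin d → ℝ, 0 ≤ t → t ≤ 1 → 0 ≤ U →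
      (∀ j, 0 ≤ q j) → ∑ j, 5 * (t * gradSize A V x) * U * q j ≤
        ε * (t * weight A V x * ∑ j, q j ^ 2 + t * weight A V x ^ 2 * U ^ 2) + C * U ^ 2 := by
  have hd : (0 : ℝ) < 5 * (d + 1) := by positivity
  -- The 5 cancels the prefactor, and `d + 1` pays for the sum over `j`, in which the `U²` term
  -- occurs `d` times.
  obtain ⟨C, hC, hG⟩ := h.gradSize_le (ε / (5 * (d + 1))) (by positivity)
  refine ⟨d * (25 * C ^ 2 / (2 * ε)), by positivity, fun x hx t U q ht ht1 hU hq => ?_⟩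
  set m := weight A V x with hm
  have hm1 : 1 ≤ m := one_le_weight x
  have key : ∀ j, 5 * (t * gradSize A V x) * U * q j ≤
      ε / (2 * (d + 1)) * (t * m * q j ^ 2 + t * m ^ 2 * U ^ 2) + ε / 2 * (t * m * q j ^ 2)
        + 25 * C ^ 2 / (2 * ε) * U ^ 2 := fun j => by
    have hUq : 0 ≤ t * U * q j := mul_nonneg (mul_nonneg ht hU) (hq j)
    have h1 := mul_le_mul_of_nonneg_right (hG x hx) hUq
    -- The decisive splitting: `m^{3/2} U q = (√m q) (m U)`.
    have h2 : m * √m * (U * q j) ≤ (m * q j ^ 2 + m ^ 2 * U ^ 2) / 2 := by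
      have h3 := Real.sq_sqrt (show 0 ≤ m by linarith)
      nlinarith [sq_nonneg (√m * q j - m * U)]
    have h2' := mul_le_mul_of_nonneg_left h2 (show 0 ≤ ε / (d + 1) * t by positivity)
    -- The additive constant in the gradient bound goes into the main term through `1 ≤ m`, at the
    -- price of a multiple of `U²`.
    have h4 : 5 * C * (U * q j) ≤ ε / 2 * q j ^ 2 + 25 * C ^ 2 / (2 * ε) * U ^ 2 := by
      have : ε / 2 * q j ^ 2 + 25 * C ^ 2 / (2 * ε) * U ^ 2 - 5 * C * (U * q j)
          = (ε * q j - 5 * C * U) ^ 2 / (2 * ε) := by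
        field_simp
        ring
      have h5 : 0 ≤ (ε * q j - 5 * C * U) ^ 2 / (2 * ε) := by positivity
      linarith
    have h4' := mul_le_mul_of_nonneg_left h4 ht
    have h6 : t * (ε / 2 * q j ^ 2) ≤ ε / 2 * (t * m * q j ^ 2) := by
      have : 0 ≤ ε / 2 * (t * q j ^ 2) := by positivity
      nlinarith
    have h7 : t * (25 * C ^ 2 / (2 * ε) * U ^ 2) ≤ 25 * C ^ 2 / (2 * ε) * U ^ 2 :=
      mul_le_of_le_one_left (by positivity) ht1
    have e1 : 5 * (ε / (5 * (d + 1)) * (m * √m) * (t * U * q j))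
        = ε / (d + 1) * t * (m * √m * (U * q j)) := by
      field_simp
    have e2 : ε / (d + 1) * t * ((m * q j ^ 2 + m ^ 2 * U ^ 2) / 2)
        = ε / (2 * (d + 1)) * (t * m * q j ^ 2 + t * m ^ 2 * U ^ 2) := by
      field_simp
    rw [e2] at h2'
    linarith
  refine (Finset.sum_le_sum fun j _ => key j).trans ?_
  simp only [Finset.sum_add_distrib, ← Finset.mul_sum, Finset.sum_const, Finset.card_univ,
    Fintype.card_fin, nsmul_eq_mul]
  set D := t * m * ∑ j, q j ^ 2 with hD
  set E := t * m ^ 2 * U ^ 2 with hE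
  have hD0 : 0 ≤ D := by positivity
  have hE0 : 0 ≤ E := by positivity
  have e3 : ε / (2 * (d + 1)) ≤ ε / 2 := by
    gcongr
    linarith [(Nat.cast_nonneg d : (0 : ℝ) ≤ d)]
  have e4 : ε / (2 * (d + 1)) * (d * E) ≤ ε / 2 * E := by
    rw [← mul_assoc]
    gcongr
    rw [div_mul_eq_mul_div, div_le_div_iff₀ (by positivity) (by norm_num)]
    nlinarith
  nlinarith [mul_le_mul_of_nonneg_right e3 hD0, mul_nonneg hε.le hE0]

end Damping

/-! ### The damped kinetic and potential integrals. -/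

section Densities

variable {d : ℕ} {Ω : Set (Euc d)} {A : Euc d → Euc d} {V : Euc d → ℂ}

theorem integrable_norm_mul_norm (a b : L2 Ω) :
    Integrable (fun x => ‖a x‖ * ‖b x‖) (volume.restrict Ω) :=
  (Lp.memLp a).norm.integrable_mul (Lp.memLp b).norm

theorem integrable_bdd_mul_norm (hΩ : IsOpen Ω) {c : Euc d → ℝ} (hc : ContinuousOn c Ω) {K : ℝ}
    (hK : ∀ x ∈ Ω, |c x| ≤ K) (a b : L2 Ω) :
    Integrable (fun x => c x * (‖a x‖ * ‖b x‖)) (volume.restrict Ω) :=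
  (integrable_norm_mul_norm a b).bdd_mul (hc.aestronglyMeasurable hΩ.measurableSet)
    ((ae_restrict_iff' hΩ.measurableSet).2 (ae_of_all _ hK))

theorem integrable_norm_sq (a : L2 Ω) :
    Integrable (fun x => ‖a x‖ ^ 2) (volume.restrict Ω) := by
  simpa only [sq] using integrable_norm_mul_norm a a

theorem integrable_bdd_mul_norm_sq (hΩ : IsOpen Ω) {c : Euc d → ℝ} (hc : ContinuousOn c Ω) {K : ℝ}
    (hK : ∀ x ∈ Ω, |c x| ≤ K) (a : L2 Ω) :
    Integrable (fun x => c x * ‖a x‖ ^ 2) (volume.restrict Ω) := by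
  simpa only [sq] using integrable_bdd_mul_norm hΩ hc hK a a

theorem integral_norm_sq (a : L2 Ω) : ∫ x in Ω, ‖a x‖ ^ 2 = ‖a‖ ^ 2 := by
  have h := inner_self_eq_norm_sq_to_K (𝕜 := ℂ) a
  rw [MeasureTheory.L2.inner_def] at h
  simp only [inner_self_eq_norm_sq_to_K] at h
  have h2 : ((∫ x in Ω, ‖a x‖ ^ 2 : ℝ) : ℂ) = ((‖a‖ ^ 2 : ℝ) : ℂ) := by
    rw [← integral_complex_ofReal]
    simpa using h
  exact_mod_cast h2

theorem BddOn.integrable (hΩ : IsOpen Ω) {c : Euc d → ℂ} (hc : BddOn Ω c) (a b : L2 Ω) :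
    Integrable (fun x => ‖c x‖ * (‖a x‖ * ‖b x‖)) (volume.restrict Ω) := by
  obtain ⟨K, hK⟩ := hc.bound
  exact integrable_bdd_mul_norm hΩ hc.continuousOn.norm (fun x hx => by simpa using hK x hx) a b

theorem inner_mulOp (hΩ : IsOpen Ω) {c : Euc d → ℂ} (hc : BddOn Ω c) (a b : L2 Ω) :
    inner ℂ (mulOp hΩ hc a) b = ∫ x in Ω, conj (c x) * (b x * conj (a x)) := by
  rw [MeasureTheory.L2.inner_def]
  refine integral_congr_ae ?_
  filter_upwards [mulOp_coeFn hΩ hc a] with x hx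
  rw [RCLike.inner_apply, hx, map_mul]
  ring

theorem norm_inner_mulOp_le (hΩ : IsOpen Ω) {c : Euc d → ℂ} (hc : BddOn Ω c) (a b : L2 Ω) :
    ‖inner ℂ (mulOp hΩ hc a) b‖ ≤ ∫ x in Ω, ‖c x‖ * (‖a x‖ * ‖b x‖) := by
  rw [inner_mulOp]
  refine (norm_integral_le_integral_norm _).trans (le_of_eq ?_)
  refine integral_congr_ae (ae_of_all _ fun x => ?_)
  simp only [norm_mul, RCLike.norm_conj]
  ring

/-- `∫ (1 + s m²)⁻² m |g|²`, to be used with `g = (-i∇ + A) u`. -/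
noncomputable def kinetic (A : Euc d → Euc d) (V : Euc d → ℂ) (s : ℝ) (g : Fin d → L2 Ω) : ℝ :=
  ∫ x in Ω, damp A V s x * weight A V x * ∑ j, ‖g j x‖ ^ 2

/-- `∫ (1 + s m²)⁻² m² |u|²`. -/
noncomputable def potential (A : Euc d → Euc d) (V : Euc d → ℂ) (s : ℝ) (u : L2 Ω) : ℝ :=
  ∫ x in Ω, damp A V s x * weight A V x ^ 2 * ‖u x‖ ^ 2

variable {s : ℝ}

theorem Admissible.integrable_potential (h : Admissible Ω A V) (hs : 0 < s) (u : L2 Ω) :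
    Integrable (fun x => damp A V s x * weight A V x ^ 2 * ‖u x‖ ^ 2) (volume.restrict Ω) := by
  refine integrable_bdd_mul_norm_sq h.isOpen (K := 1 / s)
    ((h.contDiffOn_damp hs).continuousOn.mul h.contDiffOn_weight_sq.continuousOn) (fun x _ => ?_) u
  rw [Pi.mul_apply, abs_of_nonneg (mul_nonneg (damp_pos hs x).le (sq_nonneg _))]
  exact damp_mul_weight_sq_le hs x

theorem Admissible.integrable_kinetic (h : Admissible Ω A V) (hs : 0 < s) (g : Fin d → L2 Ω) :
    Integrable (fun x => damp A V s x * weight A V x * ∑ j, ‖g j x‖ ^ 2)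
      (volume.restrict Ω) := by
  simp only [Finset.mul_sum]
  refine integrable_finsetSum _ fun j _ => integrable_bdd_mul_norm_sq h.isOpen (K := 1 / s)
    ((h.contDiffOn_damp hs).continuousOn.mul h.contDiffOn_weight.continuousOn) (fun x _ => ?_) (g j)
  rw [Pi.mul_apply, abs_of_nonneg (mul_nonneg (damp_pos hs x).le (weight_pos x).le)]
  exact damp_mul_weight_le hs x

theorem kinetic_nonneg (hs : 0 < s) (g : Fin d → L2 Ω) : 0 ≤ kinetic A V s g :=
  integral_nonneg fun x => mul_nonneg (mul_nonneg (damp_pos hs x).le (weight_pos x).le)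
    (Finset.sum_nonneg fun _ _ => sq_nonneg _)

theorem potential_nonneg (hs : 0 < s) (u : L2 Ω) : 0 ≤ potential A V s u :=
  integral_nonneg fun x => mul_nonneg (mul_nonneg (damp_pos hs x).le (sq_nonneg _)) (sq_nonneg _)

theorem setIntegral_mono_of_mem (hΩ : IsOpen Ω) {f g : Euc d → ℝ}
    (hf : Integrable f (volume.restrict Ω)) (hg : Integrable g (volume.restrict Ω))
    (hfg : ∀ x ∈ Ω, f x ≤ g x) : ∫ x in Ω, f x ≤ ∫ x in Ω, g x :=
  setIntegral_mono_on hf hg hΩ.measurableSet hfg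

/-- The terms in which a derivative falls on a damped symbol are small with respect to the kinetic
and potential integrals, up to a multiple of `‖u‖²`. -/
theorem Admissible.exists_error_le (h : Admissible Ω A V) {ε : ℝ} (hε : 0 < ε) :
    ∃ C : ℝ, 0 ≤ C ∧ ∀ (s : ℝ) (hs : 0 < s) (F : Euc d → ℂ) (hF : IsSymbol Ω A V F) (u : L2 Ω)
      (g : Fin d → L2 Ω) (l : Fin d → Fin d),
      ∑ k, ‖inner ℂ (mulOp h.isOpen ((hF.isMultiplier h hs).bddOn_pderiv (l k)) u) (g k)‖ ≤
        ε * (kinetic A V s g + potential A V s u) + C * ‖u‖ ^ 2 := by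
  obtain ⟨C, hC, H⟩ := h.exists_sum_gradSize_le hε
  -- The map `l` decouples the direction of the derivative from the component of `g`: the identity
  -- serves the form, and constant maps serve the commutator.
  refine ⟨C, hC, fun s hs F hF u g l => ?_⟩
  have hi := fun k => ((hF.isMultiplier h hs).bddOn_pderiv (l k)).integrable h.isOpen u (g k)
  have hDE : Integrable (fun x => ε * (damp A V s x * weight A V x * ∑ j, ‖g j x‖ ^ 2 +
      damp A V s x * weight A V x ^ 2 * ‖u x‖ ^ 2)) (volume.restrict Ω) :=
    ((h.integrable_kinetic hs g).add (h.integrable_potential hs u)).const_mul ε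
  refine (Finset.sum_le_sum fun k _ => norm_inner_mulOp_le _ _ _ _).trans ?_
  rw [← integral_finsetSum _ fun k _ => hi k, ← integral_norm_sq, kinetic, potential,
    ← integral_add (h.integrable_kinetic hs g) (h.integrable_potential hs u),
    ← integral_const_mul, ← integral_const_mul, ← integral_add hDE
      ((integrable_norm_sq u).const_mul C)]
  refine setIntegral_mono_of_mem h.isOpen (integrable_finsetSum _ fun k _ => hi k)
    (hDE.add ((integrable_norm_sq u).const_mul C)) fun x hx => ?_
  refine le_trans (Finset.sum_le_sum fun k _ => ?_) (H x hx (damp A V s x) ‖u x‖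
    (fun k => ‖g k x‖) (damp_pos hs x).le (damp_le_one hs x) (norm_nonneg _)
    fun _ => norm_nonneg _)
  rw [mul_assoc (5 * _)]
  exact mul_le_mul_of_nonneg_right (hF.norm_pderiv_dampMul_le h hs (l k) hx) (by positivity)

theorem norm_mul_norm_le_sum {ι : Type*} [Fintype ι] (q : ι → ℝ) (j k : ι) :
    q j * q k ≤ ∑ i, q i ^ 2 := by
  have h : ∀ i, q i ^ 2 ≤ ∑ i, q i ^ 2 := fun i =>
    Finset.single_le_sum (f := fun i => q i ^ 2) (fun _ _ => sq_nonneg _) (Finset.mem_univ i)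
  nlinarith [h j, h k, sq_nonneg (q j - q k)]

theorem IsSymbol.norm_inner_le_kinetic (h : Admissible Ω A V) (hs : 0 < s) {F : Euc d → ℂ}
    (hF : IsSymbol Ω A V F) (g : Fin d → L2 Ω) (j k : Fin d) :
    ‖inner ℂ (mulOp h.isOpen (hF.isMultiplier h hs).bddOn (g j)) (g k)‖ ≤ kinetic A V s g := by
  refine (norm_inner_mulOp_le _ _ _ _).trans (setIntegral_mono_of_mem h.isOpen
    ((hF.isMultiplier h hs).bddOn.integrable h.isOpen _ _) (h.integrable_kinetic hs g)
    fun x hx => ?_)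
  exact mul_le_mul (hF.norm_dampMul_le hs hx) (norm_mul_norm_le_sum (fun k => ‖g k x‖) j k)
    (by positivity) (mul_nonneg (damp_pos hs x).le (weight_pos x).le)

/-- Summing under the integral, before comparison with `kinetic`, avoids a factor `d`. -/
theorem IsSymbol.norm_sum_inner_le_kinetic (h : Admissible Ω A V) (hs : 0 < s) {F : Euc d → ℂ}
    (hF : IsSymbol Ω A V F) (g : Fin d → L2 Ω) :
    ‖∑ j, inner ℂ (mulOp h.isOpen (hF.isMultiplier h hs).bddOn (g j)) (g j)‖ ≤
      kinetic A V s g := by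
  have hi := fun j => (hF.isMultiplier h hs).bddOn.integrable h.isOpen (g j) (g j)
  refine (norm_sum_le _ _).trans
    ((Finset.sum_le_sum fun j _ => norm_inner_mulOp_le _ _ _ _).trans ?_)
  rw [← integral_finsetSum _ fun j _ => hi j]
  refine setIntegral_mono_of_mem h.isOpen (integrable_finsetSum _ fun j _ => hi j)
    (h.integrable_kinetic hs g) fun x hx => ?_
  rw [Finset.mul_sum]
  refine Finset.sum_le_sum fun j _ => ?_
  rw [← sq]
  exact mul_le_mul_of_nonneg_right (hF.norm_dampMul_le hs hx) (sq_nonneg _)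

/-- For the symbol `m` the main term is the kinetic integral exactly; this equality lets the form
bound `kinetic` from above. -/
theorem Admissible.sum_inner_weight (h : Admissible Ω A V) (hs : 0 < s) (g : Fin d → L2 Ω) :
    ∑ j, inner ℂ (mulOp h.isOpen (h.isSymbol_weight.isMultiplier h hs).bddOn (g j)) (g j) =
      (kinetic A V s g : ℂ) := by
  rw [kinetic, ← integral_complex_ofReal]
  simp only [inner_mulOp]
  rw [← integral_finsetSum]
  · refine integral_congr_ae (ae_of_all _ fun x => ?_)
    simp only [dampMul, map_mul, Complex.conj_ofReal, Complex.mul_conj', ← Finset.mul_sum]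
    push_cast
    ring
  · intro j _
    have h1 := MeasureTheory.L2.integrable_inner (𝕜 := ℂ)
      (mulOp h.isOpen (h.isSymbol_weight.isMultiplier h hs).bddOn (g j)) (g j)
    refine h1.congr ?_
    filter_upwards [mulOp_coeFn h.isOpen (h.isSymbol_weight.isMultiplier h hs).bddOn (g j)]
      with x hx
    rw [RCLike.inner_apply, hx, map_mul]
    ring

/-- Pointwise, `damp · Re V ≥ -ε damp m - C`, since `damp ≤ 1`. The cost is an undamped `‖Pu‖²`,
which the energy identity controls. -/
theorem Admissible.exists_re_sum_inner_potential_ge (h : Admissible Ω A V) {ε : ℝ} (hε : 0 < ε) :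
    ∃ C : ℝ, 0 ≤ C ∧ ∀ (s : ℝ) (hs : 0 < s) (g : Fin d → L2 Ω),
      -(ε * kinetic A V s g) - C * ∑ j, ‖g j‖ ^ 2 ≤
        (∑ j, inner ℂ (mulOp h.isOpen (h.isSymbol_potential.isMultiplier h hs).bddOn (g j))
          (g j)).re := by
  obtain ⟨C, hC, H⟩ := h.neg_re_le ε hε
  refine ⟨C, hC, fun s hs g => ?_⟩
  have hI : ∀ j, Integrable (fun x => conj (dampMul A V s V x) * (g j x * conj (g j x)))
      (volume.restrict Ω) := fun j => by
    have h1 := MeasureTheory.L2.integrable_inner (𝕜 := ℂ)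
      (mulOp h.isOpen (h.isSymbol_potential.isMultiplier h hs).bddOn (g j)) (g j)
    refine h1.congr ?_
    filter_upwards [mulOp_coeFn h.isOpen (h.isSymbol_potential.isMultiplier h hs).bddOn (g j)]
      with x hx
    rw [RCLike.inner_apply, hx, map_mul]
    ring
  have hJ : Integrable (fun x => ∑ j, ‖g j x‖ ^ 2) (volume.restrict Ω) :=
    integrable_finsetSum _ fun j _ => integrable_norm_sq (g j)
  have hD : Integrable (fun x => -(ε * (damp A V s x * weight A V x * ∑ j, ‖g j x‖ ^ 2)))
      (volume.restrict Ω) := ((h.integrable_kinetic hs g).const_mul ε).neg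
  simp only [inner_mulOp, ← integral_norm_sq]
  rw [← integral_finsetSum _ fun j _ => hI j,
    ← integral_finsetSum _ fun j _ => integrable_norm_sq (g j), kinetic, ← integral_const_mul,
    ← integral_const_mul, ← integral_neg, ← integral_sub hD (hJ.const_mul C),
    ← RCLike.re_eq_complex_re, ← integral_re (integrable_finsetSum _ fun j _ => hI j)]
  refine setIntegral_mono_of_mem h.isOpen (hD.sub (hJ.const_mul C))
    (integrable_finsetSum _ fun j _ => hI j).re fun x hx => ?_
  have e : (∑ j, conj (dampMul A V s V x) * (g j x * conj (g j x)))
      = ((damp A V s x * ∑ j, ‖g j x‖ ^ 2 : ℝ) : ℂ) * conj (V x) := by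
    simp only [dampMul, map_mul, Complex.conj_ofReal, Complex.mul_conj', ← Finset.mul_sum]
    push_cast
    ring
  rw [e, RCLike.re_eq_complex_re, Complex.re_ofReal_mul, Complex.conj_re]
  have h0 : 0 ≤ ∑ j, ‖g j x‖ ^ 2 := Finset.sum_nonneg fun _ _ => sq_nonneg _
  have h1 := mul_le_mul_of_nonneg_left (H x hx)
    (mul_nonneg (damp_pos (A := A) (V := V) hs x).le h0)
  have h2 := mul_le_mul_of_nonneg_right (damp_le_one (A := A) (V := V) hs x) (mul_nonneg hC h0)
  linarith

/-- Since `damp² ≤ damp`, one damping factor can be dropped: `|damp F|² ≤ damp m²`. -/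
theorem IsSymbol.norm_mulOp_sq_le (h : Admissible Ω A V) (hs : 0 < s) {F : Euc d → ℂ}
    (hF : IsSymbol Ω A V F) (u : L2 Ω) :
    ‖mulOp h.isOpen (hF.isMultiplier h hs).bddOn u‖ ^ 2 ≤ potential A V s u := by
  rw [← integral_norm_sq, potential]
  refine integral_mono_ae (integrable_norm_sq _) (h.integrable_potential hs u) ?_
  filter_upwards [mulOp_coeFn h.isOpen (hF.isMultiplier h hs).bddOn u,
    ae_restrict_mem h.isOpen.measurableSet] with x hx hxΩ
  rw [hx, norm_mul, mul_pow]
  refine mul_le_mul_of_nonneg_right ?_ (sq_nonneg _)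
  refine (pow_le_pow_left₀ (norm_nonneg _) (hF.norm_dampMul_le hs hxΩ) 2).trans ?_
  rw [mul_pow]
  refine mul_le_mul_of_nonneg_right ?_ (sq_nonneg _)
  nlinarith [damp_pos (A := A) (V := V) hs x, damp_le_one (A := A) (V := V) hs x]

end Densities

/-! ### The a priori estimate, uniform in the damping. -/

section Estimates

variable {d : ℕ} {Ω : Set (Euc d)} {A : Euc d → Euc d} {V : Euc d → ℂ} {s : ℝ}

theorem magGraph_of_mem_formDomain (h : Admissible Ω A V) {u : L2 Ω}
    (hu : u ∈ formDomain Ω A V) : (u, fun j => weakP Ω A j u) ∈ magGraph Ω A :=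
  (mem_magGraph_iff h.isOpen h.continuousOn_A).2 ⟨hu.1, rfl⟩

theorem IsMultiplier.weakP_mulOp (h : Admissible Ω A V) {w : Euc d → ℂ} (hw : IsMultiplier Ω w)
    {u : L2 Ω} (hu : u ∈ formDomain Ω A V) (j : Fin d) :
    weakP Ω A j (mulOp h.isOpen hw.bddOn u) = mulOp h.isOpen hw.bddOn (weakP Ω A j u)
      - Complex.I • mulOp h.isOpen (hw.bddOn_pderiv j) u :=
  (congrFun ((mem_magGraph_iff h.isOpen h.continuousOn_A).1 (hw.mem_magGraph h.isOpen
    h.continuousOn_A (magGraph_of_mem_formDomain h hu))).2 j).symm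

theorem IsMultiplier.mem_formDomain (h : Admissible Ω A V) {w : Euc d → ℂ}
    (hw : IsMultiplier Ω w) {u : L2 Ω} (hu : u ∈ formDomain Ω A V) :
    mulOp h.isOpen hw.bddOn u ∈ formDomain Ω A V := by
  refine ⟨((mem_magGraph_iff h.isOpen h.continuousOn_A).1 (hw.mem_magGraph h.isOpen
    h.continuousOn_A (magGraph_of_mem_formDomain h hu))).1, ?_⟩
  have h1 : MemLp (w * fun x => (√‖V x‖ : ℂ) * u x) 2 (volume.restrict Ω) :=
    MemLp.mul (p := ∞) (q := 2) hu.2 (hw.bddOn.memLp_top h.isOpen)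
  refine h1.ae_eq ?_
  filter_upwards [mulOp_coeFn h.isOpen hw.bddOn u] with x hx
  rw [hx, Pi.mul_apply]
  ring

/-- `⟨(-i∇ + A) u, (-i∇ + A) v⟩`. -/
noncomputable def magPairing {d : ℕ} {Ω : Set (Euc d)} (A : Euc d → Euc d) (u v : L2 Ω) : ℂ :=
  ∑ j, inner ℂ (weakP Ω A j v) (weakP Ω A j u)

/-- By the Leibniz rule the difference consists only of terms with `∂_j` on the damped symbol, which
`Admissible.exists_error_le` makes small. -/
theorem Admissible.exists_magPairing_sub_le (h : Admissible Ω A V) {ε : ℝ} (hε : 0 < ε) :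
    ∃ C : ℝ, 0 ≤ C ∧ ∀ (s : ℝ) (hs : 0 < s) (F : Euc d → ℂ) (hF : IsSymbol Ω A V F) (u : L2 Ω),
      u ∈ formDomain Ω A V →
      ‖magPairing A u (mulOp h.isOpen (hF.isMultiplier h hs).bddOn u) -
        ∑ j, inner ℂ (mulOp h.isOpen (hF.isMultiplier h hs).bddOn (weakP Ω A j u))
          (weakP Ω A j u)‖ ≤
        ε * (kinetic A V s (fun j => weakP Ω A j u) + potential A V s u) + C * ‖u‖ ^ 2 := by
  obtain ⟨C, hC, H⟩ := h.exists_error_le hε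
  refine ⟨C, hC, fun s hs F hF u hu => ?_⟩
  refine le_trans ?_ (H s hs F hF u (fun j => weakP Ω A j u) id)
  rw [magPairing, ← Finset.sum_sub_distrib]
  refine (norm_sum_le _ _).trans (Finset.sum_le_sum fun j _ => ?_)
  rw [(hF.isMultiplier h hs).weakP_mulOp h hu, inner_sub_left, sub_sub_cancel_left, norm_neg,
    inner_smul_left, norm_mul]
  simp

theorem Admissible.integrable_damp_mul (h : Admissible Ω A V) (hs : 0 < s) {c : Euc d → ℝ}
    (hc : ContinuousOn c Ω) (hcm : ∀ x ∈ Ω, |c x| ≤ weight A V x) (u : L2 Ω) :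
    Integrable (fun x => damp A V s x * c x ^ 2 * ‖u x‖ ^ 2) (volume.restrict Ω) := by
  refine integrable_bdd_mul_norm_sq h.isOpen (K := 1 / s)
    (c := fun x => damp A V s x * c x ^ 2)
    ((h.contDiffOn_damp hs).continuousOn.mul (hc.pow 2)) (fun x hx => ?_) u
  rw [abs_of_nonneg (mul_nonneg (damp_pos hs x).le (sq_nonneg _))]
  refine le_trans (mul_le_mul_of_nonneg_left ?_ (damp_pos hs x).le) (damp_mul_weight_sq_le hs x)
  rw [← sq_abs]
  exact pow_le_pow_left₀ (abs_nonneg _) (hcm x hx) 2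

/-- The magnetic part of the potential integral is controlled by the kinetic integral. -/
theorem Admissible.exists_integral_magB_le (h : Admissible Ω A V) {ε : ℝ} (hε : 0 < ε) :
    ∃ C : ℝ, 0 ≤ C ∧ ∀ (s : ℝ), 0 < s → ∀ (u : L2 Ω), u ∈ formDomain Ω A V → ∀ j k,
      ∫ x in Ω, damp A V s x * magB A j k x ^ 2 * ‖u x‖ ^ 2 ≤
        2 * (kinetic A V s (fun j => weakP Ω A j u) +
          (ε * (kinetic A V s (fun j => weakP Ω A j u) + potential A V s u) + C * ‖u‖ ^ 2)) := by
  obtain ⟨C, hC, H⟩ := h.exists_error_le hε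
  refine ⟨C, hC, fun s hs u hu j k => ?_⟩
  set g := fun j => weakP Ω A j u with hg
  have hF := h.isSymbol_magB j k
  have hw := hF.isMultiplier h hs
  have hwB : BddOn Ω fun x => ((damp A V s x * magB A j k x * magB A j k x : ℝ) : ℂ) := by
    refine ⟨Complex.continuous_ofReal.comp_continuousOn
      (((h.contDiffOn_damp hs).continuousOn.mul (h.contDiffOn_magB j k).continuousOn).mul
        (h.contDiffOn_magB j k).continuousOn), 1 / s, fun x _ => ?_⟩
    rw [Complex.norm_real, Real.norm_eq_abs, mul_assoc, ← sq,
      abs_of_nonneg (mul_nonneg (damp_pos hs x).le (sq_nonneg _))]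
    refine le_trans (mul_le_mul_of_nonneg_left ?_ (damp_pos hs x).le) (damp_mul_weight_sq_le hs x)
    rw [← sq_abs]
    exact pow_le_pow_left₀ (abs_nonneg _) (abs_magB_le_weight j k x) 2
  -- The damped symbol is a product of two complex casts, while `magGraph_commutator` wants the cast
  -- of a real product. Generalizing over `W` lets `rfl` replace one by the other inside the
  -- dependent `mulOp` terms.
  have key : ∀ (W : Euc d → ℂ) (hW : IsMultiplier Ω W),
      W = (fun x => ((damp A V s x * magB A j k x : ℝ) : ℂ)) →
      inner ℂ (mulOp h.isOpen hW.bddOn (g j)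
          - Complex.I • mulOp h.isOpen (hW.bddOn_pderiv j) u) (g k)
        - inner ℂ (mulOp h.isOpen hW.bddOn (g k)
          - Complex.I • mulOp h.isOpen (hW.bddOn_pderiv k) u) (g j)
        + Complex.I * inner ℂ u (mulOp h.isOpen hwB u) = 0 := by
    rintro W hW rfl
    exact magGraph_commutator (w := fun x => damp A V s x * magB A j k x) (p := (u, g)) h.isOpen
      (h.contDiffOn_A.of_le (by norm_num)) hW hwB (magGraph_of_mem_formDomain h hu)
  have h1 := key _ hw (by ext x; simp [dampMul])
  have h2 : inner ℂ u (mulOp h.isOpen hwB u) =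
      ((∫ x in Ω, damp A V s x * magB A j k x ^ 2 * ‖u x‖ ^ 2 : ℝ) : ℂ) := by
    rw [← integral_complex_ofReal, MeasureTheory.L2.inner_def]
    refine integral_congr_ae ?_
    filter_upwards [mulOp_coeFn h.isOpen hwB u] with x hx
    rw [RCLike.inner_apply, hx, mul_assoc, Complex.mul_conj']
    push_cast
    ring
  have h0 : 0 ≤ ∫ x in Ω, damp A V s x * magB A j k x ^ 2 * ‖u x‖ ^ 2 :=
    integral_nonneg fun x => mul_nonneg (mul_nonneg (damp_pos hs x).le (sq_nonneg _)) (sq_nonneg _)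
  rw [h2] at h1
  have h3 : ‖Complex.I * ((∫ x in Ω, damp A V s x * magB A j k x ^ 2 * ‖u x‖ ^ 2 : ℝ) : ℂ)‖ =
      ∫ x in Ω, damp A V s x * magB A j k x ^ 2 * ‖u x‖ ^ 2 := by
    rw [norm_mul, Complex.norm_I, one_mul, Complex.norm_real, Real.norm_eq_abs, abs_of_nonneg h0]
  -- Each of the two inner products in the commutator identity costs one `kinetic` plus one error,
  -- which gives the factor 2.
  have hterm : ∀ a b, ‖inner ℂ (mulOp h.isOpen hw.bddOn (g a)
      - Complex.I • mulOp h.isOpen (hw.bddOn_pderiv a) u) (g b)‖ ≤ kinetic A V s g +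
        (ε * (kinetic A V s g + potential A V s u) + C * ‖u‖ ^ 2) := fun a b => by
    rw [inner_sub_left, inner_smul_left]
    refine (norm_sub_le _ _).trans (add_le_add (hF.norm_inner_le_kinetic h hs g a b) ?_)
    refine le_trans ?_ (H s hs _ hF u g fun _ => a)
    rw [norm_mul]
    simp only [Complex.conj_I, norm_neg, Complex.norm_I, one_mul]
    exact Finset.single_le_sum (f := fun k => ‖inner ℂ (mulOp h.isOpen (hw.bddOn_pderiv a) u)
      (g k)‖) (fun _ _ => norm_nonneg _) (Finset.mem_univ b)
  rw [← h3, eq_neg_of_add_eq_zero_right h1, norm_neg]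
  refine (norm_sub_le _ _).trans ?_
  rw [two_mul]
  exact add_le_add (hterm j k) (hterm k j)

theorem Admissible.potential_eq (h : Admissible Ω A V) (hs : 0 < s) (u : L2 Ω) :
    potential A V s u = (∫ x in Ω, damp A V s x * ‖u x‖ ^ 2) +
      (∑ j, ∑ k, ∫ x in Ω, damp A V s x * magB A j k x ^ 2 * ‖u x‖ ^ 2) +
      ∫ x in Ω, damp A V s x * ‖V x‖ ^ 2 * ‖u x‖ ^ 2 := by
  have i1 : Integrable (fun x => damp A V s x * ‖u x‖ ^ 2) (volume.restrict Ω) := by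
    simpa using h.integrable_damp_mul hs (c := fun _ => 1) continuousOn_const
      (fun x _ => by simpa using one_le_weight x) u
  have i2 := fun j k => h.integrable_damp_mul hs (h.contDiffOn_magB j k).continuousOn
    (fun x _ => abs_magB_le_weight j k x) u
  have i3 := h.integrable_damp_mul hs h.contDiffOn_V.continuousOn.norm
    (fun x _ => by simpa using norm_le_weight x) u
  have i2' := fun j => integrable_finsetSum Finset.univ fun k _ => i2 j k
  have i2'' := integrable_finsetSum Finset.univ fun j _ => i2' j
  have e : ∀ j, ∑ k, ∫ x in Ω, damp A V s x * magB A j k x ^ 2 * ‖u x‖ ^ 2 =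
      ∫ x in Ω, ∑ k, damp A V s x * magB A j k x ^ 2 * ‖u x‖ ^ 2 := fun j =>
    (integral_finsetSum _ fun k _ => i2 j k).symm
  simp only [e]
  rw [← integral_finsetSum _ fun j _ => i2' j, ← integral_add i1 i2'']
  rw [← integral_add]
  rotate_left
  · exact i1.add i2''
  · exact i3
  refine integral_congr_ae (ae_of_all _ fun x => ?_)
  simp only [weight_sq, normB_sq, ← Finset.mul_sum, ← Finset.sum_mul]
  ring

/-- Here `-Re V ≤ (ε/2) m + C` is multiplied by `damp m |u|²`; the term `C m` is split by Young's
inequality into another `(ε/2) m²` and the constant `C² / (2ε)`. -/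
theorem Admissible.exists_re_integral_weight_ge (h : Admissible Ω A V) {ε : ℝ} (hε : 0 < ε) :
    ∃ C : ℝ, 0 ≤ C ∧ ∀ (s : ℝ) (hs : 0 < s) (u : L2 Ω), u ∈ formDomain Ω A V →
      -(ε * potential A V s u) - C * ‖u‖ ^ 2 ≤ (∫ x in Ω, V x * u x *
        conj ((mulOp h.isOpen (h.isSymbol_weight.isMultiplier h hs).bddOn u : L2 Ω) x)).re := by
  obtain ⟨C, hC, H⟩ := h.neg_re_le (ε / 2) (half_pos hε)
  refine ⟨C ^ 2 / (2 * ε), by positivity, fun s hs u hu => ?_⟩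
  have hI := MagneticSchrodinger.integrable_potential h.isOpen h.contDiffOn_V.continuousOn hu
    ((h.isSymbol_weight.isMultiplier h hs).mem_formDomain h hu)
  have hE : Integrable (fun x => -(ε * (damp A V s x * weight A V x ^ 2 * ‖u x‖ ^ 2)))
      (volume.restrict Ω) := ((h.integrable_potential hs u).const_mul ε).neg
  have hU := (integrable_norm_sq u).const_mul (C ^ 2 / (2 * ε))
  rw [← RCLike.re_eq_complex_re, ← integral_re hI, potential, ← integral_norm_sq,
    ← integral_const_mul, ← integral_const_mul, ← integral_neg, ← integral_sub hE hU]
  refine integral_mono_ae (hE.sub hU) hI.re ?_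
  filter_upwards [mulOp_coeFn h.isOpen (h.isSymbol_weight.isMultiplier h hs).bddOn u,
    ae_restrict_mem h.isOpen.measurableSet] with x hx hxΩ
  have e : V x * u x * conj ((mulOp h.isOpen (h.isSymbol_weight.isMultiplier h hs).bddOn u : L2 Ω) x)
      = ((damp A V s x * weight A V x * ‖u x‖ ^ 2 : ℝ) : ℂ) * V x := by
    rw [hx, map_mul, dampMul, map_mul, Complex.conj_ofReal, Complex.conj_ofReal]
    calc _ = (damp A V s x : ℂ) * weight A V x * (u x * conj (u x)) * V x := by ring
      _ = _ := by
        rw [Complex.mul_conj']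
        push_cast
        ring
  change _ ≤ (V x * u x * conj ((mulOp h.isOpen
    (h.isSymbol_weight.isMultiplier h hs).bddOn u : L2 Ω) x)).re
  rw [e, Complex.re_ofReal_mul]
  set t := damp A V s x
  set m := weight A V x
  have ht : 0 ≤ t := (damp_pos hs x).le
  have hm : 0 ≤ m := (weight_pos x).le
  have h1 := mul_le_mul_of_nonneg_left (H x hxΩ) (show 0 ≤ t * m * ‖u x‖ ^ 2 by positivity)
  have h2 : C * m ≤ ε / 2 * m ^ 2 + C ^ 2 / (2 * ε) := by
    have : ε / 2 * m ^ 2 + C ^ 2 / (2 * ε) - C * m = (ε * m - C) ^ 2 / (2 * ε) := by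
      field_simp
      ring
    have h5 : 0 ≤ (ε * m - C) ^ 2 / (2 * ε) := by positivity
    linarith
  have h3 := mul_le_mul_of_nonneg_left h2 (show 0 ≤ t * ‖u x‖ ^ 2 by positivity)
  have h4 := mul_le_mul_of_nonneg_right (damp_le_one (A := A) (V := V) hs x)
    (show 0 ≤ C ^ 2 / (2 * ε) * ‖u x‖ ^ 2 by positivity)
  linarith

/-- The conjugation in the second slot turns the symbol `V` into `V̄`, so the product is `|V|²` even
for complex `V`. -/
theorem Admissible.integral_potential_eq (h : Admissible Ω A V) (hs : 0 < s) (u : L2 Ω) :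
    ∫ x in Ω, V x * u x *
      conj ((mulOp h.isOpen (h.isSymbol_potential.isMultiplier h hs).bddOn u : L2 Ω) x) =
      ((∫ x in Ω, damp A V s x * ‖V x‖ ^ 2 * ‖u x‖ ^ 2 : ℝ) : ℂ) := by
  rw [← integral_complex_ofReal]
  refine integral_congr_ae ?_
  filter_upwards [mulOp_coeFn h.isOpen (h.isSymbol_potential.isMultiplier h hs).bddOn u] with x hx
  rw [hx, map_mul, dampMul, map_mul, Complex.conj_ofReal]
  calc _ = (damp A V s x : ℂ) * (V x * conj (V x)) * (u x * conj (u x)) := by ring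
    _ = _ := by
      rw [Complex.mul_conj', Complex.mul_conj']
      push_cast
      ring

theorem mul_le_eps_mul_sq_add {a b P ε : ℝ} (hε : 0 < ε) (hP : a ^ 2 ≤ P) :
    a * b ≤ ε * P + b ^ 2 / (4 * ε) := by
  have : ε * a ^ 2 + b ^ 2 / (4 * ε) - a * b = (2 * ε * a - b) ^ 2 / (4 * ε) := by
    field_simp
    ring
  have h5 : 0 ≤ (2 * ε * a - b) ^ 2 / (4 * ε) := by positivity
  nlinarith

/-- The a priori estimate of the damped kinetic and potential integrals, uniform in the damping. -/
theorem Admissible.exists_kinetic_add_potential_le (h : Admissible Ω A V) :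
    ∃ K : ℝ, 0 ≤ K ∧ ∀ (s : ℝ), 0 < s → ∀ (u f : L2 Ω), u ∈ formDomain Ω A V →
      (∀ v ∈ formDomain Ω A V, form Ω A V u v = inner ℂ v f) →
      kinetic A V s (fun j => weakP Ω A j u) + potential A V s u ≤ K * (‖u‖ ^ 2 + ‖f‖ ^ 2) := by
  -- The coefficient of `X` in the bound for `Y`: `2X` for each of the `d²` entries `B_jk`, and `X`
  -- for `V`. With `ε = 1 / (32 K₀)` the errors remain absorbable after multiplication by `K₀`.
  set K₀ : ℝ := 2 * d ^ 2 + 1 with hK₀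
  have hK₀1 : 1 ≤ K₀ := by
    have := sq_nonneg (d : ℝ)
    linarith
  set ε : ℝ := 1 / (32 * K₀) with hε_def
  have hε : 0 < ε := by positivity
  have hεK : ε * K₀ = 1 / 32 := by
    rw [hε_def]
    field_simp
  have hε32 : ε ≤ 1 / 32 := by nlinarith
  obtain ⟨C₁, hC₁, H₁⟩ := h.exists_magPairing_sub_le hε
  obtain ⟨C₂, hC₂, H₂⟩ := h.exists_integral_magB_le hε
  obtain ⟨C₃, hC₃, H₃⟩ := h.exists_re_integral_weight_ge hε
  set a := C₁ + C₃ + 1 / (4 * ε) with ha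
  set b := 1 + d ^ 2 * (2 * C₂) + C₁ + 1 / (4 * ε) with hb
  refine ⟨8 * (K₀ * a + b), by positivity, fun s hs u f hu hf => ?_⟩
  set X := kinetic A V s fun j => weakP Ω A j u with hX
  set Y := potential A V s u with hY
  have hX0 : 0 ≤ X := kinetic_nonneg hs _
  have hY0 : 0 ≤ Y := potential_nonneg hs _
  set N := ‖u‖ ^ 2 + ‖f‖ ^ 2 with hN
  have huN : ‖u‖ ^ 2 ≤ N := by
    have := sq_nonneg ‖f‖
    linarith
  have hfN : ‖f‖ ^ 2 ≤ N := by
    have := sq_nonneg ‖u‖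
    linarith
  have hinner : ∀ (F : Euc d → ℂ) (hF : IsSymbol Ω A V F),
      ‖inner ℂ (mulOp h.isOpen (hF.isMultiplier h hs).bddOn u) f‖ ≤ ε * Y + 1 / (4 * ε) * N :=
    fun F hF => by
      refine (norm_inner_le_norm _ _).trans ((mul_le_eps_mul_sq_add hε
        (hF.norm_mulOp_sq_le h hs u)).trans ?_)
      have := mul_le_mul_of_nonneg_left hfN (show 0 ≤ 1 / (4 * ε) by positivity)
      rw [one_div_mul_eq_div] at this
      linarith
  -- Test vector `damp m u`. Of the `4 ε Y`, three parts come from the gradient error, the negative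
  -- part of `Re V` and the pairing with `f`; the fourth is slack.
  have hkin : X ≤ ε * X + 4 * ε * Y + a * N := by
    have hF := h.isSymbol_weight
    have e1 := hf _ ((hF.isMultiplier h hs).mem_formDomain h hu)
    have e2 := H₁ s hs _ hF u hu
    have e3 := H₃ s hs u hu
    have e4 := hinner _ hF
    rw [h.sum_inner_weight hs, ← hX] at e2
    have e5 := (Complex.re_le_norm _).trans e4
    rw [← e1, form, Complex.add_re] at e5
    have e6 := (Complex.abs_re_le_norm _).trans e2
    rw [Complex.sub_re, Complex.ofReal_re] at e6
    have e7 := (abs_le.1 e6).1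
    rw [magPairing] at e7
    have e8 := mul_le_mul_of_nonneg_left huN hC₁
    have e9 := mul_le_mul_of_nonneg_left huN hC₃
    rw [ha]
    have : 0 ≤ ε * Y := mul_nonneg hε.le hY0
    linarith
  -- Test vector `damp V u`. The main gradient term `S` is complex without a sign and is bounded in
  -- modulus by `X`.
  have hpot : ∫ x in Ω, damp A V s x * ‖V x‖ ^ 2 * ‖u x‖ ^ 2 ≤
      X + ε * (X + Y) + ε * Y + (C₁ + 1 / (4 * ε)) * N := by
    have hF := h.isSymbol_potential
    have e1 := hf _ ((hF.isMultiplier h hs).mem_formDomain h hu)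
    have e2 := H₁ s hs _ hF u hu
    have e4 := hinner _ hF
    have e5 := hF.norm_sum_inner_le_kinetic h hs fun j => weakP Ω A j u
    rw [form, h.integral_potential_eq hs u] at e1
    set S := ∑ j, inner ℂ (mulOp h.isOpen (hF.isMultiplier h hs).bddOn (weakP Ω A j u))
          (weakP Ω A j u)
    set P := magPairing A u (mulOp h.isOpen (hF.isMultiplier h hs).bddOn u) with hP
    rw [magPairing] at hP
    rw [← hP] at e1
    have e6 : ((∫ x in Ω, damp A V s x * ‖V x‖ ^ 2 * ‖u x‖ ^ 2 : ℝ) : ℂ) =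
        inner ℂ (mulOp h.isOpen (hF.isMultiplier h hs).bddOn u) f - (P - S) - S := by
      rw [← e1]
      ring
    have e7 := Complex.re_le_norm (((∫ x in Ω, damp A V s x * ‖V x‖ ^ 2 * ‖u x‖ ^ 2 : ℝ) : ℂ))
    rw [Complex.ofReal_re, e6] at e7
    have e8 := mul_le_mul_of_nonneg_left huN hC₁
    have e9 := e7.trans ((norm_sub_le _ _).trans (add_le_add (norm_sub_le _ _) le_rfl))
    linarith
  have hone : ∫ x in Ω, damp A V s x * ‖u x‖ ^ 2 ≤ N := by
    refine le_trans ?_ huN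
    rw [← integral_norm_sq]
    refine integral_mono_of_nonneg (ae_of_all _ fun x => mul_nonneg (damp_pos hs x).le
      (sq_nonneg _)) (integrable_norm_sq u) (ae_of_all _ fun x => ?_)
    exact mul_le_of_le_one_left (sq_nonneg _) (damp_le_one hs x)
  have hmag : ∑ j, ∑ k, ∫ x in Ω, damp A V s x * magB A j k x ^ 2 * ‖u x‖ ^ 2 ≤
      d ^ 2 * (2 * (X + (ε * (X + Y) + C₂ * N))) := by
    refine (Finset.sum_le_sum fun j _ => Finset.sum_le_sum fun k _ =>
      (H₂ s hs u hu j k).trans (show _ ≤ 2 * (X + (ε * (X + Y) + C₂ * N)) from ?_)).trans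
      (le_of_eq ?_)
    · have := mul_le_mul_of_nonneg_left huN hC₂
      linarith
    · simp
      ring
  have hpe := h.potential_eq hs u
  rw [← hY] at hpe
  have hYb : Y ≤ K₀ * X + (ε * K₀) * (X + Y) + ε * Y + b * N := by
    rw [hb, hK₀]
    nlinarith
  rw [hεK] at hYb
  -- The kinetic bound is multiplied by `K₀` and inserted twice, for `X` and for `Y`. On the right,
  -- `X` and `Y` then carry coefficients below 1/2, so the constant 8 leaves room to spare.
  have hZ : K₀ * X ≤ K₀ * (ε * X + 4 * ε * Y + a * N) :=
    mul_le_mul_of_nonneg_left hkin (by linarith)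
  have e1 : K₀ * (ε * X + 4 * ε * Y + a * N) = 1 / 32 * X + 1 / 8 * Y + K₀ * a * N := by
    linear_combination (X + 4 * Y) * hεK
  rw [e1] at hZ
  have hXZ : X ≤ K₀ * X := le_mul_of_one_le_left hX0 hK₀1
  have hεY : ε * Y ≤ 1 / 32 * Y := mul_le_mul_of_nonneg_right hε32 hY0
  have hN0 : 0 ≤ N := by positivity
  have hp1 : 0 ≤ K₀ * a * N := by positivity
  have hp2 : 0 ≤ b * N := by positivity
  have e2 : 8 * (K₀ * a + b) * N = 8 * (K₀ * a * N) + 8 * (b * N) := by ring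
  rw [e2]
  linarith

end Estimates

/-! ### Removal of the damping, the cross term and separation. -/

section Laplacian

variable {d : ℕ} {Ω : Set (Euc d)} {A : Euc d → Euc d} {V : Euc d → ℂ}

theorem IsTest.conj {φ : Euc d → ℂ} (hφ : IsTest Ω φ) : IsTest Ω fun x => conj (φ x) := by
  have hts : tsupport (fun x => conj (φ x)) ⊆ tsupport φ :=
    closure_mono fun x (hx : conj (φ x) ≠ 0) (h0 : φ x = 0) => hx (by simp [h0])
  exact ⟨Complex.conjCLE.contDiff.comp hφ.smooth,
    IsCompact.of_isClosed_subset hφ.compact (isClosed_tsupport _) hts, hts.trans hφ.supp⟩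

/-- Translates between the bilinear pairing of distributions and the sesquilinear inner product;
hence the conjugated test functions below. -/
theorem IsTest.magPt_conj {φ : Euc d → ℂ} (hφ : IsTest Ω φ) (j : Fin d) (x : Euc d) :
    magPt A j (fun y => conj (φ y)) x = conj (magP A j φ x) := by
  simp only [magPt, magP, pderiv_conj (hφ.smooth.differentiable (by simp) x), map_add, map_mul,
    map_neg, Complex.conj_I, Complex.conj_ofReal, neg_neg]

theorem inner_eq_setIntegral {φ : Euc d → ℂ} {v : L2 Ω} (hv : v =ᵐ[volume.restrict Ω] φ)
    (g : L2 Ω) : inner ℂ v g = ∫ x in Ω, g x * conj (φ x) := by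
  rw [MeasureTheory.L2.inner_def]
  refine integral_congr_ae ?_
  filter_upwards [hv] with x hx
  rw [RCLike.inner_apply, hx]

/-- The weak equation `(-i∇ + A)² u = g` can be tested against `H¹_{A,0}(Ω)`. -/
theorem HasWeakMagLaplacian.magPairing_eq (hΩ : IsOpen Ω) (hA : ContinuousOn A Ω) {u g : L2 Ω}
    (hg : HasWeakMagLaplacian Ω A u g) {v : L2 Ω} (hv : v ∈ H1A0 Ω A) :
    magPairing A u v = inner ℂ v g := by
  have h1 : (v, fun j => weakP Ω A j v) ∈ magGraph Ω A := (mem_magGraph_iff hΩ hA).2 ⟨hv, rfl⟩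
  refine closure_minimal (t := {p : L2 Ω × (Fin d → L2 Ω) |
    ∑ j, inner ℂ (p.2 j) (weakP Ω A j u) = inner ℂ p.1 g}) ?_ ?_ h1
  swap
  · exact isClosed_eq (by fun_prop) (by fun_prop)
  rintro p ⟨φ, hφ, e1, e2⟩
  rw [Set.mem_ofPred_eq, inner_eq_setIntegral e1, hg.2 _ hφ.conj]
  refine Finset.sum_congr rfl fun j _ => ?_
  simp only [inner_eq_setIntegral (e2 j), hφ.magPt_conj]

/-- If `Q(u, v) = ⟨f, v⟩` on `𝒱` and `V u ∈ L²(Ω)`, then `(-i∇ + A)² u = f - V u`. -/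
theorem hasWeakMagLaplacian_of_form_eq (hΩ : IsOpen Ω) (hA : ContinuousOn A Ω)
    (hV : ContinuousOn V Ω) {u f w : L2 Ω} (hu : u ∈ formDomain Ω A V)
    (hf : ∀ v ∈ formDomain Ω A V, form Ω A V u v = inner ℂ v f)
    (hw : ∀ᵐ x ∂volume.restrict Ω, w x = V x * u x) : HasWeakMagLaplacian Ω A u (f - w) := by
  refine ⟨hu.1.1, fun φ hφ => ?_⟩
  have hψ := hφ.conj
  have e1 := hf _ (hψ.mem_formDomain hΩ hA hV)
  have e2 : ∫ x in Ω, V x * u x * conj (((hψ.memLp hΩ).toLp _ : L2 Ω) x) =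
      inner ℂ ((hψ.memLp hΩ).toLp _ : L2 Ω) w := by
    rw [inner_eq_setIntegral (φ := ((hψ.memLp hΩ).toLp _ : L2 Ω)) (ae_of_all _ fun _ => rfl)]
    refine integral_congr_ae ?_
    filter_upwards [hw] with x hx
    rw [hx]
  rw [form, e2] at e1
  have e3 := inner_eq_setIntegral (hψ.memLp hΩ).coeFn_toLp (f - w)
  simp only [Complex.conj_conj] at e3
  rw [← e3, inner_sub_right, ← e1, add_sub_cancel_right]
  refine Finset.sum_congr rfl fun j _ => ?_
  rw [(hψ.hasWeakP hΩ hA j).weakP_eq hΩ,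
    inner_eq_setIntegral (hψ.memLp_magP hΩ hA j).coeFn_toLp]
  simp only [← hψ.magPt_conj, Complex.conj_conj]

theorem integral_potential_eq_inner {u w : L2 Ω}
    (hw : ∀ᵐ x ∂volume.restrict Ω, w x = V x * u x) (v : L2 Ω) :
    ∫ x in Ω, V x * u x * conj (v x) = inner ℂ v w := by
  rw [inner_eq_setIntegral (φ := v) (ae_of_all _ fun _ => rfl)]
  refine integral_congr_ae ?_
  filter_upwards [hw] with x hx
  rw [hx]

theorem tendsto_damp (x : Euc d) :
    Tendsto (fun n : ℕ => damp A V (1 / ((n : ℝ) + 1)) x) atTop (𝓝 1) := by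
  have h : ContinuousAt (fun s : ℝ => damp A V s x) 0 := by
    unfold damp
    refine ContinuousAt.inv₀ (by fun_prop) (by norm_num)
  have h0 : damp A V 0 x = 1 := by simp [damp]
  rw [ContinuousAt, h0] at h
  exact h.comp tendsto_one_div_add_atTop_nhds_zero_nat

/-- If `Q(u, ·)` is represented by an element of `L²(Ω)`, then `V u ∈ L²(Ω)`. -/
theorem Admissible.memLp_potential_mul (h : Admissible Ω A V) {u f : L2 Ω}
    (hu : u ∈ formDomain Ω A V) (hf : ∀ v ∈ formDomain Ω A V, form Ω A V u v = inner ℂ v f) :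
    MemLp (fun x => V x * u x) 2 (volume.restrict Ω) := by
  obtain ⟨K, hK, H⟩ := h.exists_kinetic_add_potential_le
  have hm : AEStronglyMeasurable (fun x => V x * u x) (volume.restrict Ω) :=
    (h.contDiffOn_V.continuousOn.aestronglyMeasurable h.isOpen.measurableSet).mul
      (Lp.aestronglyMeasurable u)
  refine ⟨hm, ?_⟩
  have hs : ∀ n : ℕ, (0 : ℝ) < 1 / ((n : ℝ) + 1) := fun n => Nat.one_div_pos_of_nat
  let v : ℕ → L2 Ω := fun n =>
    mulOp h.isOpen (h.isSymbol_potential.isMultiplier h (hs n)).bddOn u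
  have hv : ∀ n, eLpNorm (v n) 2 (volume.restrict Ω) ≤
      ENNReal.ofReal √(K * (‖u‖ ^ 2 + ‖f‖ ^ 2)) := fun n => by
    rw [← Lp.enorm_def, ← ofReal_norm]
    refine ENNReal.ofReal_le_ofReal (Real.le_sqrt_of_sq_le ?_)
    have h1 := h.isSymbol_potential.norm_mulOp_sq_le h (hs n) u
    have h2 := H _ (hs n) u f hu hf
    have h3 := kinetic_nonneg (A := A) (V := V) (hs n) fun j => weakP Ω A j u
    linarith
  have hlim : ∀ᵐ x ∂volume.restrict Ω, Tendsto (fun n => v n x) atTop (𝓝 (V x * u x)) := by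
    filter_upwards [ae_all_iff.2 fun n => mulOp_coeFn h.isOpen
      (h.isSymbol_potential.isMultiplier h (hs n)).bddOn u] with x hx
    have h1 := ((Complex.continuous_ofReal.tendsto _).comp
      (tendsto_damp (A := A) (V := V) x)).mul_const (V x * u x)
    rw [Complex.ofReal_one, one_mul] at h1
    refine h1.congr fun n => ?_
    rw [hx n, dampMul, mul_assoc]
    rfl
  -- Fatou's lemma: the damped products converge almost everywhere to `V u` with norms bounded
  -- independently of `n`.
  refine (Lp.eLpNorm_lim_le_liminf_eLpNorm (fun n => Lp.aestronglyMeasurable (v n)) _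
    hlim).trans_lt (lt_of_le_of_lt ?_ (ENNReal.ofReal_lt_top (r := √(K * (‖u‖ ^ 2 + ‖f‖ ^ 2)))))
  exact liminf_le_of_le (by isBoundedDefault) fun b hb =>
    let ⟨n, hn⟩ := hb.exists
    hn.trans (hv n)

/-- The cross term `Re ⟨(-i∇ + A)² u, V u⟩` is almost non-negative. -/
theorem Admissible.exists_re_inner_ge (h : Admissible Ω A V) {ε : ℝ} (hε : 0 < ε) :
    ∃ C : ℝ, 0 ≤ C ∧ ∀ u f w : L2 Ω, u ∈ formDomain Ω A V →
      (∀ v ∈ formDomain Ω A V, form Ω A V u v = inner ℂ v f) →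
      (∀ᵐ x ∂volume.restrict Ω, w x = V x * u x) →
      -(ε * (‖u‖ ^ 2 + ‖f‖ ^ 2)) - C * (‖u‖ * ‖f - w‖ + ‖u‖ ^ 2) ≤ (inner ℂ w (f - w)).re := by
  obtain ⟨K, hK, H⟩ := h.exists_kinetic_add_potential_le
  -- Two errors of size at most `η (X + Y) ≤ η K (‖u‖² + ‖f‖²)` occur; `K + 1` avoids division by
  -- zero.
  set η := ε / (2 * (K + 1)) with hη_def
  have hη : 0 < η := by positivity
  obtain ⟨C₁, hC₁, H₁⟩ := h.exists_magPairing_sub_le hη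
  obtain ⟨C₂, hC₂, H₂⟩ := h.exists_re_sum_inner_potential_ge hη
  refine ⟨C₁ + C₂, add_nonneg hC₁ hC₂, fun u f w hu hf hw => ?_⟩
  have hpair : ∀ v ∈ formDomain Ω A V, magPairing A u v = inner ℂ v (f - w) := fun v hv => by
    rw [inner_sub_right, ← hf v hv, form, integral_potential_eq_inner hw, magPairing,
      add_sub_cancel_right]
  -- Energy identity `‖Pu‖² = ⟨P²u, u⟩`, with `P²u = f - w`.
  have hgrad : ∑ j, ‖weakP Ω A j u‖ ^ 2 ≤ ‖u‖ * ‖f - w‖ := by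
    have e1 : ∑ j, ‖weakP Ω A j u‖ ^ 2 = (magPairing A u u).re := by
      rw [magPairing, Complex.re_sum]
      exact Finset.sum_congr rfl fun j _ => (inner_self_eq_norm_sq (𝕜 := ℂ) _).symm
    rw [e1, hpair u hu]
    exact (Complex.re_le_norm _).trans (norm_inner_le_norm _ _)
  have hs : ∀ n : ℕ, (0 : ℝ) < 1 / ((n : ℝ) + 1) := fun n => Nat.one_div_pos_of_nat
  let v : ℕ → L2 Ω := fun n =>
    mulOp h.isOpen (h.isSymbol_potential.isMultiplier h (hs n)).bddOn u
  have hvb : ∀ n, -(ε * (‖u‖ ^ 2 + ‖f‖ ^ 2)) - (C₁ + C₂) * (‖u‖ * ‖f - w‖ + ‖u‖ ^ 2) ≤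
      (inner ℂ (v n) (f - w)).re := fun n => by
    have e1 := H _ (hs n) u f hu hf
    have e2 := H₁ _ (hs n) V h.isSymbol_potential u hu
    have e3 := H₂ _ (hs n) fun j => weakP Ω A j u
    have e4 := hpair (v n) ((h.isSymbol_potential.isMultiplier h (hs n)).mem_formDomain h hu)
    have e5 := (abs_le.1 ((Complex.abs_re_le_norm _).trans e2)).1
    rw [Complex.sub_re] at e5
    rw [← e4]
    set X := kinetic A V (1 / ((n : ℝ) + 1)) fun j => weakP Ω A j u
    set Y := potential A V (1 / ((n : ℝ) + 1)) u
    have hY : 0 ≤ Y := potential_nonneg (hs n) _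
    have e6 : η * X + η * (X + Y) ≤ ε * (‖u‖ ^ 2 + ‖f‖ ^ 2) := by
      calc η * X + η * (X + Y) ≤ 2 * η * (X + Y) := by nlinarith
        _ ≤ 2 * η * (K * (‖u‖ ^ 2 + ‖f‖ ^ 2)) := by gcongr
        _ ≤ 2 * η * ((K + 1) * (‖u‖ ^ 2 + ‖f‖ ^ 2)) := by
          gcongr
          linarith
        _ = _ := by
          rw [hη_def]
          field_simp
    have e7 := mul_le_mul_of_nonneg_left hgrad hC₂
    have e8 : 0 ≤ C₁ * (‖u‖ * ‖f - w‖) := by positivity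
    have e9 : 0 ≤ C₂ * ‖u‖ ^ 2 := by positivity
    linarith
  -- Since `Vu ∈ L²` is now known and `0 < damp ≤ 1`, dominated convergence removes the damping.
  have hlim : Tendsto (fun n => inner ℂ (v n) (f - w)) atTop (𝓝 (inner ℂ w (f - w))) := by
    simp only [MeasureTheory.L2.inner_def]
    refine tendsto_integral_of_dominated_convergence (fun x => ‖w x‖ * ‖(f - w : L2 Ω) x‖)
      (fun n => (MeasureTheory.L2.integrable_inner (v n) (f - w)).1)
      (integrable_norm_mul_norm w (f - w)) (fun n => ?_) ?_
    · filter_upwards [mulOp_coeFn h.isOpen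
        (h.isSymbol_potential.isMultiplier h (hs n)).bddOn u, hw] with x hx hwx
      refine (norm_inner_le_norm _ _).trans (mul_le_mul_of_nonneg_right ?_ (norm_nonneg _))
      rw [hx, hwx, dampMul, mul_assoc, norm_mul, Complex.norm_real, Real.norm_eq_abs,
        abs_of_pos (damp_pos (hs n) x)]
      exact mul_le_of_le_one_left (norm_nonneg _) (damp_le_one (hs n) x)
    · filter_upwards [ae_all_iff.2 fun n => mulOp_coeFn h.isOpen
        (h.isSymbol_potential.isMultiplier h (hs n)).bddOn u, hw] with x hx hwx
      refine Tendsto.inner ?_ tendsto_const_nhds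
      have h1 := ((Complex.continuous_ofReal.tendsto _).comp
        (tendsto_damp (A := A) (V := V) x)).mul_const (V x * u x)
      rw [Complex.ofReal_one, one_mul, ← hwx] at h1
      refine h1.congr fun n => ?_
      rw [hx n, dampMul, mul_assoc, hwx]
      rfl
  exact ge_of_tendsto ((Complex.continuous_re.tendsto _).comp hlim) (Eventually.of_forall hvb)

/-- The separation estimate. -/
theorem Admissible.exists_separation (h : Admissible Ω A V) {δ : ℝ} (hδ : 0 < δ) :
    ∃ C : ℝ, 0 < C ∧ ∀ u f w : L2 Ω, u ∈ formDomain Ω A V →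
      (∀ v ∈ formDomain Ω A V, form Ω A V u v = inner ℂ v f) →
      (∀ᵐ x ∂volume.restrict Ω, w x = V x * u x) →
      (1 - δ) * (‖f - w‖ ^ 2 + ‖w‖ ^ 2) - C * ‖u‖ ^ 2 ≤ ‖f‖ ^ 2 := by
  -- Twice `δ/8`, with `‖f‖² ≤ 2 (‖g‖² + ‖w‖²)`, costs `δ/2` of both squares. Young's inequality for
  -- `2C ‖u‖ ‖g‖` costs the other `δ/2` of `‖g‖²` and leaves `2C²/δ` on `‖u‖²`.
  obtain ⟨C, hC, H⟩ := h.exists_re_inner_ge (ε := δ / 8) (by positivity)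
  refine ⟨δ / 4 + 2 * C + 2 * C ^ 2 / δ, by positivity, fun u f w hu hf hw => ?_⟩
  have h1 := H u f w hu hf hw
  set g := f - w with hg
  have hfg : f = w + g := by rw [hg, add_sub_cancel]
  have h2 : ‖f‖ ^ 2 = ‖w‖ ^ 2 + 2 * (inner ℂ w g).re + ‖g‖ ^ 2 := by
    rw [hfg]
    exact norm_add_sq (𝕜 := ℂ) w g
  have h3 : ‖f‖ ^ 2 ≤ 2 * (‖g‖ ^ 2 + ‖w‖ ^ 2) := by
    have h4 : ‖f‖ ≤ ‖w‖ + ‖g‖ := hfg ▸ norm_add_le w g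
    nlinarith [norm_nonneg f, norm_nonneg w, norm_nonneg g, sq_nonneg (‖w‖ - ‖g‖)]
  have h5 : 2 * C * (‖u‖ * ‖g‖) ≤ δ / 2 * ‖g‖ ^ 2 + 2 * C ^ 2 / δ * ‖u‖ ^ 2 := by
    have : δ / 2 * ‖g‖ ^ 2 + 2 * C ^ 2 / δ * ‖u‖ ^ 2 - 2 * C * (‖u‖ * ‖g‖)
        = (δ * ‖g‖ - 2 * C * ‖u‖) ^ 2 / (2 * δ) := by
      field_simp
      ring
    have h6 : 0 ≤ (δ * ‖g‖ - 2 * C * ‖u‖) ^ 2 / (2 * δ) := by positivity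
    linarith
  have h7 := mul_le_mul_of_nonneg_left h3 hδ.le
  have h8 := mul_nonneg hδ.le (sq_nonneg ‖w‖)
  linarith

end Laplacian

end MagneticSchrodinger

/-! ### The domain and the separation estimate. -/

theorem mainTheorem3 {d : ℕ} (hd : 1 ≤ d) {Ω : Set (Euc d)} (hΩ : IsOpen Ω) (hne : Ω.Nonempty)
    {V : Euc d → ℂ} {A : Euc d → Euc d}
    (hV : ContDiffClosure 1 V Ω) (hA : ContDiffClosure 2 A Ω)
    (hgrad : (fun x => normGradV V x + normGradB A x)
      =o[Bornology.cobounded (Euc d) ⊓ 𝓟 Ω] fun x => weight A V x ^ (3 / 2 : ℝ))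
    (hneg : (fun x => max (-(V x).re) 0)
      =o[Bornology.cobounded (Euc d) ⊓ 𝓟 Ω] fun x => weight A V x) :
    (∀ u : L2 Ω, u ∈ (schrodingerOp hΩ hA.continuousOn hV.continuousOn).domain ↔
      u ∈ formDomain Ω A V ∧ (∃ f : L2 Ω, HasWeakMagLaplacian Ω A u f) ∧
        MemLp (fun x => V x * u x) 2 (volume.restrict Ω)) ∧
    ∀ δ : ℝ, 0 < δ → ∃ C : ℝ, 0 < C ∧
      ∀ u : (schrodingerOp hΩ hA.continuousOn hV.continuousOn).domain, ∃ f w : L2 Ω,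
        HasWeakMagLaplacian Ω A u f ∧ (∀ᵐ x ∂volume.restrict Ω, w x = V x * (u : L2 Ω) x) ∧
        (1 - δ) * (‖f‖ ^ 2 + ‖w‖ ^ 2) - C * ‖(u : L2 Ω)‖ ^ 2 ≤
          ‖schrodingerOp hΩ hA.continuousOn hV.continuousOn u‖ ^ 2 := by
  have h := admissible_of_isLittleO hΩ hV hA hgrad hneg
  have hspec : ∀ u : (schrodingerOp hΩ hA.continuousOn hV.continuousOn).domain,
      (u : L2 Ω) ∈ formDomain Ω A V ∧ ∀ v ∈ formDomain Ω A V,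
        form Ω A V u v = inner ℂ v (schrodingerOp hΩ hA.continuousOn hV.continuousOn u) :=
    fun u => ⟨u.2.1, fun v hv => schrodingerOp_spec hΩ hA.continuousOn hV.continuousOn u hv⟩
  have hpot : ∀ u : (schrodingerOp hΩ hA.continuousOn hV.continuousOn).domain,
      MemLp (fun x => V x * (u : L2 Ω) x) 2 (volume.restrict Ω) :=
    fun u => h.memLp_potential_mul (hspec u).1 (hspec u).2
  refine ⟨fun u => ⟨fun hu => ?_, fun ⟨hu, ⟨g, hg⟩, hVu⟩ => ⟨hu, ?_⟩⟩, fun δ hδ => ?_⟩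
  · exact ⟨hu.1, ⟨_, hasWeakMagLaplacian_of_form_eq hΩ hA.continuousOn hV.continuousOn hu.1
      (hspec ⟨u, hu⟩).2 (hpot ⟨u, hu⟩).coeFn_toLp⟩, hpot ⟨u, hu⟩⟩
  -- The soft inclusion: density of test functions gives `Q(u, v) = ⟨P²u + Vu, v⟩`, visibly
  -- continuous in `v`.
  · have hc : Continuous fun v : formDomain Ω A V => inner ℂ (v : L2 Ω) (g + hVu.toLp _) := by
      fun_prop
    refine hc.congr fun v => ?_
    rw [form, integral_potential_eq_inner hVu.coeFn_toLp, inner_add_right,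
      ← hg.magPairing_eq hΩ hA.continuousOn v.2.1, magPairing]
  · obtain ⟨C, hC, H⟩ := h.exists_separation hδ
    refine ⟨C, hC, fun u => ?_⟩
    exact ⟨_, (hpot u).toLp _, hasWeakMagLaplacian_of_form_eq hΩ hA.continuousOn hV.continuousOn
      (hspec u).1 (hspec u).2 (hpot u).coeFn_toLp, (hpot u).coeFn_toLp,
      H _ _ _ (hspec u).1 (hspec u).2 (hpot u).coeFn_toLp⟩
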